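/- Let $m\ge 2$, let $\mathbb F\subseteq\mathbb C$ be a subfield invariant under complex conjugation, and let $\mathbf H$ be the canonical Haar matrix of rank $m$: its row $0$ is $(1,\dots,1)$, and for $1\le i\le m-1$, with $s=m-i$, its row $i$ is $\sqrt{m/(s^2+s)}\,(0,\dots,0,-s,1,\dots,1)$ with $i-1$ zeros and $s$ ones. Assume that $\mathbf H$ has entries in $\mathbb F$ (for example $\mathbb F=\mathbb R$ or $\mathbb C$, or $m=2$ and any $\mathbb F$). For an $m\times m$ matrix $A(z)=\sum_k A_kz^{-k}$ over $\mathbb F[z,z^{-1}]$ put $\tilde A(z)=\sum_k A_k^*z^{k}$. The genus of $A\neq 0$ is $k_1-k_0+1$, where $k_0,k_1$ are the smallest and the largest $k$ with $A_k\ne0$; $A(z)$ is called an $m\times mg$ matrix if its nonzero coefficients $A_k$ fit into $g$ consecutive indices (i.e. its genus is at most $g$), and is then identified with the block matrix $(A_{k_0},\dots,A_{k_0+g-1})$. A pair $(L,R)$ is a biorthogonal wavelet pair of rank $m$ if $L(z)\tilde R(z)=mI_m$ and in both block matrices row $0$ has sum $m$ and every other row has sum $0$. Then a pair $(L,R)$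 of $m\times mg$ matrices over $\mathbb F[z,z^{-1}]$ is a biorthogonal wavelet pair of rank $m$ if and only if there are $k_0\in\mathbb Z$, $d\ge0$, $r\ge1$, primitive paraunitary matrices $V_i(z)=I_m-v_iv_i^*+v_iv_i^*z^{-1}$ ($1\le i\le d$) with coefficients in $\mathbb F$, where the $v_i\in\mathbb C^m$ are unit column vectors, matrices $N_i\in gl(m,\mathbb F)$ with $N_i^2=0$ and integers $k_i\ge1$ ($1\le i\le r$), and $G\in GL(m-1,\mathbb F)$, such that, with $L_{N_i}(z)=I_m-N_i+N_iz^{-k_i}$ and $R_{N_i}(z)=I_m+N_i^*-N_i^*z^{k_i}$, $$L(z)=z^{-k_0}V_1(z)\cdots V_d(z)\,L_{N_r}(z)\cdots L_{N_1}(z)\begin{pmatrix}1&0\\0&G\end{pmatrix}\mathbf H,$$ $$R(z)=z^{-k_0}V_1(z)\cdots V_d(z)\,R_{N_r}(z)\cdots R_{N_1}(z)\begin{pmatrix}1&0\\0&(G^{-1})^*\end{pmatrix}\mathbf H,$$ where $\det L(z)=cz^{-b}$ with $c\neq0$, $d=b-mk_0$, and the genus of $L_{N_r}(z)\cdots L_{N_1}(z)$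 is at most $g$. If moreover every nonzero vector of $\mathbb F^m$ has a scalar multiple by an element of $\mathbb F$ that is a unit vector (for example if $\mathbb F=\mathbb R$ or $\mathbb C$), then the same equivalence holds with all $v_i\in\mathbb F^m$. -/

import Mathlib

open scoped LaurentPolynomial Matrix

noncomputable section

namespace BiorthWavelet

/-- `m × m` matrices over the ring of complex Laurent polynomials in `z`; the variable `z ^ n`
is `LaurentPolynomial.T n`. -/
abbrev LMat (m : ℕ) : Type := Matrix (Fin m) (Fin m) ℂ[T;T⁻¹]

/-- A matrix over `F[z, z⁻¹]`, viewed over `ℂ[z, z⁻¹]`. -/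
def toComplex (F : Subfield ℂ) {m : ℕ} (A : Matrix (Fin m) (Fin m) F[T;T⁻¹]) : LMat m :=
  A.map (AddMonoidAlgebra.mapRingHom ℤ F.subtype)

/-- A constant matrix, viewed as a matrix of Laurent polynomials. -/
def const {m : ℕ} (A : Matrix (Fin m) (Fin m) ℂ) : LMat m := A.map LaurentPolynomial.C

/-- The scalar Laurent polynomial `z ^ n`. -/
def zPow (n : ℤ) : ℂ[T;T⁻¹] := LaurentPolynomial.T n

/-- The block `A_k` in the expansion `A(z) = ∑ A_k z^{-k}`. -/
def block {m : ℕ} (A : LMat m) (k : ℤ) : Matrix (Fin m) (Fin m) ℂ :=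
  Matrix.of fun i j => (A i j).coeff (-k)

/-- The finite set of the indices `k` with `A_k ≠ 0`. -/
def blockSupport {m : ℕ} (A : LMat m) : Finset ℤ :=
  Finset.univ.biUnion fun i : Fin m => Finset.univ.biUnion fun j : Fin m =>
    (A i j).coeff.support.image fun n => -n

theorem mem_blockSupport {m : ℕ} (A : LMat m) (k : ℤ) :
    k ∈ blockSupport A ↔ block A k ≠ 0 := by
  have h : block A k ≠ 0 ↔ ∃ i j, (A i j).coeff (-k) ≠ 0 := by
    constructor
    · intro h
      by_contra! h'
      exact h (by ext i j; simpa [block] using h' i j)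
    · rintro ⟨i, j, hij⟩ h0
      exact hij (by simpa [block] using congrFun (congrFun h0 i) j)
  rw [h]
  simp [blockSupport, neg_eq_iff_eq_neg]

/-- The genus `k₁ - k₀ + 1`, where `k₀` and `k₁` are the smallest and the largest index of a
nonzero block; the zero matrix gets genus `0`. -/
def genus {m : ℕ} (A : LMat m) : ℕ :=
  if h : (blockSupport A).Nonempty then
    ((blockSupport A).max' h - (blockSupport A).min' h + 1).toNat
  else 0

/-- `A(z)` is an `m × mg` matrix: its nonzero blocks fit into `g` consecutive blocks
(blocks that are zero are allowed at the ends). -/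
def HasSize {m : ℕ} (A : LMat m) (g : ℕ) : Prop := genus A ≤ g

/-- The adjoint `Ã(z) = ∑ A_k^* z^k`. -/
def adj {m : ℕ} (A : LMat m) : LMat m :=
  Matrix.of fun i j =>
    LaurentPolynomial.invert (AddMonoidAlgebra.mapRingHom ℤ (starRingEnd ℂ) (A j i))

/-- The sum of the `i`-th row of the block matrix `(A_{k₀}, …, A_{k₁})`. -/
def rowSum {m : ℕ} (A : LMat m) (i : Fin m) : ℂ :=
  ∑ k ∈ blockSupport A, ∑ j, block A k i j

/-- Biorthogonal wavelet matrix pairs of rank `m`. -/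
structure IsBiorthogonalWaveletPair {m : ℕ} (L R : LMat m) : Prop where
  quadratic : L * adj R = (m : ℂ[T;T⁻¹]) • (1 : LMat m)
  linear_left : ∀ i : Fin m, rowSum L i = if (i : ℕ) = 0 then (m : ℂ) else 0
  linear_right : ∀ i : Fin m, rowSum R i = if (i : ℕ) = 0 then (m : ℂ) else 0

/-- `v` is a unit column vector: `v^* v = 1`. -/
def IsUnitVector {m : ℕ} (v : Fin m → ℂ) : Prop := star v ⬝ᵥ v = 1

/-- `I - v v^* + v v^* z⁻¹`; a primitive paraunitary matrix if `v` is a unit vector. -/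
def primitiveParaunitary {m : ℕ} (v : Fin m → ℂ) : LMat m :=
  1 - const (Matrix.vecMulVec v (star v)) + zPow (-1) • const (Matrix.vecMulVec v (star v))

/-- `L_N(z) = I - N + N z^{-k}`. -/
def leftFactor {m : ℕ} (N : Matrix (Fin m) (Fin m) ℂ) (k : ℕ) : LMat m :=
  1 - const N + zPow (-(k : ℤ)) • const N

/-- `R_N(z) = I + N^* - N^* z^k`. -/
def rightFactor {m : ℕ} (N : Matrix (Fin m) (Fin m) ℂ) (k : ℕ) : LMat m :=
  1 + const Nᴴ - zPow (k : ℤ) • const Nᴴ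

/-- The block diagonal matrix `diag(1, G)`. -/
def diagOne {m : ℕ} (G : Matrix (Fin (m - 1)) (Fin (m - 1)) ℂ) : Matrix (Fin m) (Fin m) ℂ :=
  Matrix.of fun i j =>
    if hi : (i : ℕ) = 0 then (if (j : ℕ) = 0 then 1 else 0)
    else if hj : (j : ℕ) = 0 then 0
    else G ⟨(i : ℕ) - 1, by omega⟩ ⟨(j : ℕ) - 1, by omega⟩

/-- The canonical Haar matrix of rank `m`. Its row `0` is `(1, …, 1)`. With `s = m - i`, its row
`i ≥ 1` is `√(m / (s² + s)) · (0, …, 0, -s, 1, …, 1)`, with `i - 1` zeros and `s` ones. -/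
def canonicalHaar (m : ℕ) : Matrix (Fin m) (Fin m) ℂ :=
  Matrix.of fun i j =>
    if (i : ℕ) = 0 then 1
    else
      let s : ℝ := (m : ℝ) - (i : ℕ)
      if (j : ℕ) + 1 < (i : ℕ) then 0
      else if (j : ℕ) + 1 = (i : ℕ) then ((-s * √((m : ℝ) / (s ^ 2 + s)) : ℝ) : ℂ)
      else ((√((m : ℝ) / (s ^ 2 + s)) : ℝ) : ℂ)

/-- `b` is the exponent of `det A(z)`: `det A(z) = c z^{-b}` with `c ≠ 0`. -/
def IsDetExponent {m : ℕ} (A : LMat m) (b : ℤ) : Prop :=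
  ∃ c : ℂ, c ≠ 0 ∧ A.det = LaurentPolynomial.C c * zPow (-b)

/-- The factorization of a pair `(L, R)`. All factors have coefficients in `F`, and the unit
vectors that define the primitive paraunitary factors have their coordinates in `K`. -/
def HasFactorization (F K : Subfield ℂ) {m : ℕ} (g : ℕ) (L R : LMat m) : Prop :=
  ∃ (k₀ b : ℤ) (d r : ℕ) (v : Fin d → Fin m → ℂ) (N : Fin r → Matrix (Fin m) (Fin m) F)
    (k : Fin r → ℕ) (G : Matrix.GeneralLinearGroup (Fin (m - 1)) F),
    IsDetExponent L b ∧ (d : ℤ) = b - m * k₀ ∧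
    (∀ s, IsUnitVector (v s)) ∧
    (∀ s i, v s i ∈ K) ∧
    (∀ s i j, Matrix.vecMulVec (v s) (star (v s)) i j ∈ F) ∧
    0 < r ∧ (∀ i, N i ^ 2 = 0) ∧ (∀ i, 0 < k i) ∧
    genus (List.ofFn fun i => leftFactor ((N i).map F.subtype) (k i)).reverse.prod ≤ g ∧
    L = zPow (-k₀) •
      ((List.ofFn fun s => primitiveParaunitary (v s)).prod *
        (List.ofFn fun i => leftFactor ((N i).map F.subtype) (k i)).reverse.prod *
        const (diagOne ((G : Matrix (Fin (m - 1)) (Fin (m - 1)) F).map F.subtype)) *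
        const (canonicalHaar m)) ∧
    R = zPow (-k₀) •
      ((List.ofFn fun s => primitiveParaunitary (v s)).prod *
        (List.ofFn fun i => rightFactor ((N i).map F.subtype) (k i)).reverse.prod *
        const (diagOne
          (((G⁻¹ : Matrix.GeneralLinearGroup (Fin (m - 1)) F) :
            Matrix (Fin (m - 1)) (Fin (m - 1)) F).map F.subtype)ᴴ) *
        const (canonicalHaar m))

end BiorthWavelet

end

open scoped LaurentPolynomial Matrix

noncomputable section

namespace BiorthWavelet

/-! ### Factorization of polynomial matrices over a field -/

section PolynomialMatrix

open Polynomial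

/-! Sufficiency is formal. Each factor of `L` times the adjoint of its partner in `R` is `I`, the
Haar matrix satisfies `H Hᴴ = m I`, and every factor that depends on `z` becomes `I` at `z = 1`.
Since evaluation at `z = 1` adds up all blocks, the linear conditions only concern `diag(1, G) H`.

For necessity, the quadratic condition makes `det L` a unit. Up to a power of `z`, `L` is a
polynomial matrix `P` in `X = z⁻¹` over `F`, so `det P = c X ^ d`. As long as `d > 0`, `P(0)` is
singular; a left kernel vector gives a rank-one orthogonal projection `W` with `W P(0) = 0`, and `I
- W + W X` splits off on the left, lowering `d` by one without raising the degree bound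
(`exists_shiftFactor_mul`). If `P` is first divided on the right by `P(1)`, what remains is a matrix
`Q` with unit determinant and `Q(1) = I`.

Row reduction (`isNilProduct_of_natDegree_le`) turns `Q` into elementary row operations times a
constant. For `N ^ 2 = 0` one has `I + X ^ k N = (I - N + X ^ k N)(I + N)`, and constants move to
the right end by conjugation, which preserves `N ^ 2 = 0`. Evaluation at `1` shows that the final
constant is `I`. The product of the nilpotent factors is `Q` itself, so its genus is bounded
although the single exponents are not.

The remaining constant `P(1) = L(1)` equals `diag(1, G) H` by the linear conditions
(`exists_diagOne_of_linear`), and `R` is determined by `L` (`eq_of_mul_adj_eq`). The projections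
have entries in `F` in any case; the two versions of the theorem differ only in where the unit
vectors can be chosen (`exists_rank_one_projection`). -/

theorem map_C_mul {K n : Type*} [Field K] [Fintype n] (A B : Matrix n n K) :
    (A * B).map (C : K →+* K[X]) = A.map C * B.map C :=
  Matrix.map_mul

theorem map_C_one {K n : Type*} [Field K] [DecidableEq n] :
    (1 : Matrix n n K).map (C : K →+* K[X]) = 1 :=
  Matrix.map_one _ (map_zero _) (map_one _)

variable {K : Type*} [Field K] {n : Type*} [Fintype n] [DecidableEq n]

/-- The polynomial matrix `I - N + N X ^ k`. -/
def shiftFactor (N : Matrix n n K) (k : ℕ) : Matrix n n K[X] :=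
  1 - N.map C + (X : K[X]) ^ k • N.map C

/-- Polynomial matrices that are products of factors `I - N + N X ^ k`, with `N ^ 2 = 0` and
`k ≥ 1`, and an invertible constant matrix. -/
def IsNilProduct (Q : Matrix n n K[X]) : Prop :=
  ∃ l : List (Matrix n n K × ℕ), (∀ p ∈ l, p.1 ^ 2 = 0 ∧ 0 < p.2) ∧
    ∃ U : (Matrix n n K)ˣ,
      Q = (l.map fun p => shiftFactor p.1 p.2).prod * (U : Matrix n n K).map C

theorem map_C_unit_inv_mul (U : (Matrix n n K)ˣ) :
    (↑U⁻¹ : Matrix n n K).map (C : K →+* K[X]) * (U : Matrix n n K).map C = 1 := by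
  rw [← map_C_mul, Units.inv_mul, map_C_one]

/-- Conjugation lets the constants produced by row operations travel to the right end of a product.
-/
theorem unit_mul_shiftFactor (U : (Matrix n n K)ˣ) (N : Matrix n n K) (k : ℕ) :
    (U : Matrix n n K).map C * shiftFactor N k =
      shiftFactor ((U : Matrix n n K) * N * (↑U⁻¹ : Matrix n n K)) k * (U : Matrix n n K).map C := by
  have h : (U : Matrix n n K).map C * N.map C * (↑U⁻¹ : Matrix n n K).map (C : K →+* K[X])
      * (U : Matrix n n K).map C = (U : Matrix n n K).map C * N.map C := by
    rw [Matrix.mul_assoc, map_C_unit_inv_mul, Matrix.mul_one]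
  simp only [shiftFactor, map_C_mul, Matrix.mul_add, Matrix.mul_sub, Matrix.add_mul, Matrix.sub_mul,
    Matrix.mul_smul, Matrix.smul_mul, h, Matrix.mul_one, Matrix.one_mul]

theorem unit_mul_shiftFactor_prod (U : (Matrix n n K)ˣ) (l : List (Matrix n n K × ℕ))
    (hl : ∀ p ∈ l, p.1 ^ 2 = 0 ∧ 0 < p.2) :
    ∃ l' : List (Matrix n n K × ℕ), (∀ p ∈ l', p.1 ^ 2 = 0 ∧ 0 < p.2) ∧
      (U : Matrix n n K).map C * (l.map fun p => shiftFactor p.1 p.2).prod =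
        (l'.map fun p => shiftFactor p.1 p.2).prod * (U : Matrix n n K).map C := by
  refine ⟨l.map fun p => ((U : Matrix n n K) * p.1 * (↑U⁻¹ : Matrix n n K), p.2), ?_, ?_⟩
  · intro p hp
    obtain ⟨q, hq, rfl⟩ := List.mem_map.1 hp
    refine ⟨?_, (hl q hq).2⟩
    have h := (hl q hq).1
    change ((U : Matrix n n K) * q.1 * (↑U⁻¹ : Matrix n n K)) ^ 2 = 0
    rw [Units.conj_pow, h, mul_zero, zero_mul]
  · clear hl
    induction l with
    | nil => simp
    | cons p l ih =>
      simp only [List.map_cons, List.prod_cons]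
      rw [← mul_assoc, unit_mul_shiftFactor, mul_assoc, ih, ← mul_assoc]

theorem IsNilProduct.unit_mul {Q : Matrix n n K[X]} (hQ : IsNilProduct Q) (U : (Matrix n n K)ˣ) :
    IsNilProduct ((U : Matrix n n K).map C * Q) := by
  obtain ⟨l, hl, U', rfl⟩ := hQ
  obtain ⟨l', hl', h⟩ := unit_mul_shiftFactor_prod U l hl
  refine ⟨l', hl', U * U', ?_⟩
  rw [← mul_assoc, h, mul_assoc, Units.val_mul, map_C_mul]

theorem IsNilProduct.shiftFactor_mul {Q : Matrix n n K[X]} (hQ : IsNilProduct Q)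
    {N : Matrix n n K} (hN : N ^ 2 = 0) {k : ℕ} (hk : 0 < k) :
    IsNilProduct (shiftFactor N k * Q) := by
  obtain ⟨l, hl, U, rfl⟩ := hQ
  refine ⟨(N, k) :: l, ?_, U, by simp [mul_assoc]⟩
  simpa using ⟨⟨hN, hk⟩, fun a b h => hl (a, b) h⟩

/-- The unit `I + N` for `N ^ 2 = 0`. -/
def oneAddUnit (N : Matrix n n K) (hN : N ^ 2 = 0) : (Matrix n n K)ˣ where
  val := 1 + N
  inv := 1 - N
  val_inv := by rw [sq] at hN; simp [add_mul, mul_sub, hN]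
  inv_val := by rw [sq] at hN; simp [sub_mul, mul_add, hN]

/-- Rests on `(I - N + X ^ k N)(I + N) = I + X ^ k N`, where the constant `I + N` is absorbed by
`Q`. For `k = 0` the constant alone suffices, as factors with exponent `0` are not allowed. -/
theorem IsNilProduct.one_add_smul_mul {Q : Matrix n n K[X]} (hQ : IsNilProduct Q)
    {N : Matrix n n K} (hN : N ^ 2 = 0) (k : ℕ) :
    IsNilProduct ((1 + (X : K[X]) ^ k • N.map C) * Q) := by
  have h1 := hQ.unit_mul (oneAddUnit N hN)
  have hval : ((oneAddUnit N hN : (Matrix n n K)ˣ) : Matrix n n K).map (C : K →+* K[X])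
      = 1 + N.map C := by
    change (1 + N).map C = _
    rw [Matrix.map_add _ (map_add C), map_C_one]
  rw [hval] at h1
  rcases Nat.eq_zero_or_pos k with rfl | hk
  · simpa using h1
  · have h2 := h1.shiftFactor_mul hN hk
    have h0 : N.map (C : K →+* K[X]) * N.map C = 0 := by
      rw [← map_C_mul, ← sq, hN, Matrix.map_zero _ (map_zero C)]
    have h3 : shiftFactor N k * (1 + N.map C) = 1 + (X : K[X]) ^ k • N.map C := by
      simp [shiftFactor, add_mul, sub_mul, mul_add, h0]
      abel
    rwa [← mul_assoc, h3] at h2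

/-- The matrix units in positions `(i, j)`, `j ∈ s`, annihilate each other because `i ∉ s`; hence
adding multiples of several rows to row `i` at once is a product of single operations. -/
theorem IsNilProduct.row_operation_mul {Q : Matrix n n K[X]} (hQ : IsNilProduct Q) (i : n)
    (s : Finset n) (hi : i ∉ s) (c : n → K) (e : n → ℕ) :
    IsNilProduct ((1 + ∑ j ∈ s, (X : K[X]) ^ e j • (Matrix.single i j (c j)).map C) * Q) := by
  induction s using Finset.induction_on with
  | empty => simpa using hQ
  | insert j s hj ih =>
    have hij : i ≠ j := fun h => hi (by simp [h])
    have his : i ∉ s := fun h => hi (by simp [h])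
    have hN : (Matrix.single i j (c j)) ^ 2 = 0 := by
      rw [sq, Matrix.single_mul_single_of_ne _ _ _ _ hij.symm]
    have h := (ih his).one_add_smul_mul hN (e j)
    rw [← mul_assoc] at h
    suffices hE : 1 + ∑ l ∈ insert j s, (X : K[X]) ^ e l • (Matrix.single i l (c l)).map C =
        (1 + (X : K[X]) ^ e j • (Matrix.single i j (c j)).map C) *
          (1 + ∑ l ∈ s, (X : K[X]) ^ e l • (Matrix.single i l (c l)).map C) by rwa [hE]
    rw [Finset.sum_insert hj, add_mul, mul_add, mul_add, one_mul, one_mul, mul_one, Finset.mul_sum,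
      Finset.sum_eq_zero (s := s)
        (f := fun l => (X : K[X]) ^ e j • (Matrix.single i j (c j)).map C *
          (X : K[X]) ^ e l • (Matrix.single i l (c l)).map C)]
    · abel
    · intro l _
      rw [Matrix.smul_mul, Matrix.mul_smul, ← map_C_mul,
        Matrix.single_mul_single_of_ne _ _ _ _ hij.symm, Matrix.map_zero _ (map_zero C)]
      simp

/-! ### Row reduction of matrices with unit determinant -/

theorem coeff_prod_sum_of_natDegree_le {ι : Type*} (s : Finset ι) (f : ι → K[X]) (d : ι → ℕ)
    (h : ∀ i ∈ s, (f i).natDegree ≤ d i) :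
    (∏ i ∈ s, f i).coeff (∑ i ∈ s, d i) = ∏ i ∈ s, (f i).coeff (d i) := by
  classical
  induction s using Finset.induction_on with
  | empty => simp
  | insert a s ha ih =>
    have hs : ∀ i ∈ s, (f i).natDegree ≤ d i := fun i hi => h i (Finset.mem_insert_of_mem hi)
    rw [Finset.prod_insert ha, Finset.sum_insert ha, Finset.prod_insert ha,
      coeff_mul_add_eq_of_natDegree_le (h a (Finset.mem_insert_self _ _))
        ((natDegree_prod_le _ _).trans (Finset.sum_le_sum hs)), ih hs]

/-- The leading coefficient of the determinant with respect to row degree bounds. -/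
theorem coeff_det_sum_of_natDegree_le (Q : Matrix n n K[X]) (d : n → ℕ)
    (h : ∀ i j, (Q i j).natDegree ≤ d i) :
    Q.det.coeff (∑ i, d i) = (Matrix.of fun i j => (Q i j).coeff (d i)).det := by
  -- After transposing, each Leibniz term is `∏ i, Q i (σ i)`, with one factor per row, so the row
  -- bounds apply factor by factor.
  rw [← Matrix.det_transpose Q, ← Matrix.det_transpose (Matrix.of _), Matrix.det_apply,
    Matrix.det_apply, finsetSum_coeff]
  refine Finset.sum_congr rfl fun σ _ => ?_
  have := coeff_prod_sum_of_natDegree_le Finset.univ (fun i => Q i (σ i)) d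
    fun i _ => h i (σ i)
  rw [Units.smul_def, Units.smul_def, coeff_smul]
  simp only [Matrix.transpose_apply, Matrix.of_apply]
  rw [this]

/-- Row reduction: a polynomial matrix with nonzero constant determinant is a product of factors
`I - N + N X ^ k` with `N ^ 2 = 0` and an invertible constant matrix. -/
theorem isNilProduct_of_natDegree_le (s : ℕ) : ∀ (d : n → ℕ), ∑ i, d i = s →
    ∀ (Q : Matrix n n K[X]), IsUnit Q.det →
      (∀ i j, (Q i j).natDegree ≤ d i) → IsNilProduct Q := by
  classical
  induction s using Nat.strong_induction_on with
  | _ s ih =>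
    intro d hd Q hunit hdeg
    obtain ⟨c, hc', hdet⟩ := Polynomial.isUnit_iff.1 hunit
    have hc : c ≠ 0 := hc'.ne_zero
    replace hdet := hdet.symm
    rcases Nat.eq_zero_or_pos s with rfl | hs
    · have hd0 : ∀ i, d i = 0 := by simpa using hd
      have hQ : Q = (Matrix.of fun i j => (Q i j).coeff 0).map C := by
        ext1 i j
        simpa using eq_C_of_natDegree_le_zero ((hdeg i j).trans (hd0 i).le)
      have hu : IsUnit (Matrix.of fun i j => (Q i j).coeff 0) := by
        rw [Matrix.isUnit_iff_isUnit_det]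
        have := coeff_det_sum_of_natDegree_le Q d hdeg
        simp only [hd0, Finset.sum_const_zero, hdet, coeff_C_zero] at this
        rw [← this]
        exact hc.isUnit
      obtain ⟨U, hU⟩ := hu
      exact ⟨[], by simp, U, by rw [hU]; simpa using hQ⟩
    -- The determinant is constant and `s > 0`, so its coefficient at `X ^ s` vanishes: the leading
    -- row coefficients are linearly dependent.
    · have hlead : (Matrix.of fun i j => (Q i j).coeff (d i)).det = 0 := by
        rw [← coeff_det_sum_of_natDegree_le Q d hdeg, hdet, hd, coeff_C_of_ne_zero hs.ne']
      obtain ⟨w, hw0, hw⟩ := Matrix.exists_vecMul_eq_zero_iff.2 hlead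
      have hw' : ∀ j, ∑ i, w i * (Q i j).coeff (d i) = 0 := fun j => by
        simpa [Matrix.vecMul, dotProduct] using congrFun hw j
      -- The row to be reduced has the largest bound among the rows in the relation, so that the
      -- differences `d i - d l` below are not truncated.
      obtain ⟨i, hi, himax⟩ := Finset.exists_max_image (Finset.univ.filter fun i => w i ≠ 0) d
        (by
          obtain ⟨i, hi⟩ := Function.ne_iff.1 hw0
          exact ⟨i, by simpa using hi⟩)
      simp only [Finset.mem_filter, Finset.mem_univ, true_and] at hi himax
      -- Otherwise all rows in the relation are constant, and `w` is a left kernel vector of `Q`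
      -- itself.
      have hdi : 0 < d i := by
        by_contra h0
        have hconst : ∀ l, w l ≠ 0 → d l = 0 := fun l hl => by have := himax l hl; omega
        have hker : (fun l => C (w l)) ᵥ* Q = 0 := by
          funext j
          simp only [Matrix.vecMul, dotProduct, Pi.zero_apply]
          have : ∀ l, C (w l) * Q l j = C (w l * (Q l j).coeff (d l)) := fun l => by
            by_cases hl : w l = 0
            · simp [hl]
            · rw [C_mul, hconst l hl]
              congr 1
              exact eq_C_of_natDegree_le_zero ((hdeg l j).trans (hconst l hl).le)
          simp only [this]
          rw [← map_sum, hw' j, C_0]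
        have hdet0 : Q.det = 0 := Matrix.exists_vecMul_eq_zero_iff.1
          ⟨_, fun h => hi (by simpa using congrFun h i), hker⟩
        rw [hdet, C_eq_zero] at hdet0
        exact hc hdet0
      -- Adding `X ^ (d i - d l) * (w l / w i)` times row `l` to row `i`, for all `l ∈ t`, cancels
      -- the coefficient of `X ^ (d i)` and lowers the bound of row `i` by one. The operation is `1
      -- + B` with `B * B = 0`, so it is undone by `1 - B`.
      let t : Finset n := (Finset.univ.filter fun l => w l ≠ 0).erase i
      have hit : i ∉ t := Finset.notMem_erase _ _
      let e : n → ℕ := fun l => d i - d l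
      let a : n → K := fun l => w l / w i
      let B : Matrix n n K[X] := ∑ l ∈ t, (X : K[X]) ^ e l • (Matrix.single i l (a l)).map C
      have hBB : B * B = 0 := by
        simp only [B, Finset.sum_mul_sum]
        refine Finset.sum_eq_zero fun l hl => Finset.sum_eq_zero fun l' _ => ?_
        rw [Matrix.smul_mul, Matrix.mul_smul, ← map_C_mul, Matrix.single_mul_single_of_ne,
          Matrix.map_zero _ (map_zero C)]
        · simp
        · rintro rfl; exact hit hl
      have hBrow : ∀ j l, l ≠ i → (B * Q) l j = 0 := by
        intro j l hl
        simp only [B, Finset.sum_mul, Matrix.sum_apply]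
        refine Finset.sum_eq_zero fun q _ => ?_
        simp [Matrix.mul_apply, hl.symm]
      have hBi : ∀ j, (B * Q) i j = ∑ l ∈ t, X ^ e l * (C (a l) * Q l j) := by
        intro j
        simp only [B, Finset.sum_mul, Matrix.sum_apply]
        refine Finset.sum_congr rfl fun q _ => ?_
        simp [Matrix.mul_apply, Matrix.single_apply]
        ring
      have hQ : Q = (1 - B) * ((1 + B) * Q) := by
        rw [← mul_assoc, sub_mul, mul_add, mul_add, one_mul, mul_one, hBB]
        simp
      have hneg : (1 - B) = 1 + ∑ l ∈ t, (X : K[X]) ^ e l • (Matrix.single i l (-a l)).map C := by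
        rw [sub_eq_add_neg]
        congr 1
        simp only [B]
        rw [← Finset.sum_neg_distrib]
        refine Finset.sum_congr rfl fun l _ => ?_
        rw [← smul_neg]
        congr 1
        ext1 p q
        simp only [Matrix.neg_apply, Matrix.map_apply, Matrix.single_apply]
        split_ifs <;> simp
      rw [hQ, hneg]
      refine IsNilProduct.row_operation_mul ?_ i t hit (fun l => -a l) e
      have hdetB : IsUnit (1 + B).det := by
        rw [← Matrix.isUnit_iff_isUnit_det]
        refine IsUnit.of_mul_eq_one (1 - B) ?_
        simp [add_mul, mul_sub, hBB]
      refine ih (∑ l, Function.update d i (d i - 1) l) ?_ _ rfl _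
        (by rw [Matrix.det_mul]; exact hdetB.mul hunit) ?_
      · rw [← hd, Finset.sum_update_of_mem (Finset.mem_univ i),
          ← Finset.add_sum_erase _ d (Finset.mem_univ i), Finset.sdiff_singleton_eq_erase]
        omega
      · intro l j
        rw [add_mul, one_mul, Matrix.add_apply]
        by_cases hl : l = i
        · subst hl
          rw [Function.update_self, hBi]
          have hle : (Q l j + ∑ p ∈ t, X ^ e p * (C (a p) * Q p j)).natDegree ≤ d l := by
            refine natDegree_add_le_of_degree_le (hdeg l j)
              (natDegree_sum_le_of_forall_le _ _ fun p hp => ?_)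
            have hp' : d p ≤ d l := himax p (by simpa using (Finset.mem_erase.1 hp).2)
            refine natDegree_mul_le.trans ?_
            rw [natDegree_X_pow]
            have := (natDegree_C_mul_le (a p) (Q p j)).trans (hdeg p j)
            simp only [e]
            omega
          have hcoeff : (Q l j + ∑ p ∈ t, X ^ e p * (C (a p) * Q p j)).coeff (d l) = 0 := by
            have hterm : ∀ p ∈ t, (X ^ e p * (C (a p) * Q p j)).coeff (d l) =
                (w p * (Q p j).coeff (d p)) / w l := fun p hp => by
              have hp' : d p ≤ d l := himax p (by simpa using (Finset.mem_erase.1 hp).2)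
              rw [show d l = d p + e p by simp only [e]; omega, coeff_X_pow_mul, coeff_C_mul]
              simp only [a]; ring
            have hsum := hw' j
            rw [← Finset.sum_filter_of_ne (p := fun i => w i ≠ 0)
              (fun x _ hx h0 => hx (by simp [h0])),
              ← Finset.add_sum_erase _ _ (show l ∈ Finset.univ.filter fun i => w i ≠ 0 by
                simpa using hi)] at hsum
            rw [coeff_add, finsetSum_coeff, Finset.sum_congr rfl hterm, ← Finset.sum_div]
            field_simp
            simpa [t, mul_comm] using hsum
          rw [natDegree_le_iff_coeff_eq_zero] at hle ⊢
          intro N hN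
          rcases Nat.lt_or_ge (d l) N with h | h
          · exact hle N h
          · rw [show N = d l by omega]; exact hcoeff
        · rw [hBrow j l hl, add_zero, Function.update_of_ne hl]
          exact hdeg l j

theorem isNilProduct_of_isUnit_det (Q : Matrix n n K[X]) (hQ : IsUnit Q.det) :
    IsNilProduct Q :=
  isNilProduct_of_natDegree_le _ (fun i => Finset.univ.sup fun j => (Q i j).natDegree) rfl Q hQ
    fun i j => Finset.le_sup (f := fun j => (Q i j).natDegree) (Finset.mem_univ j)

/-- Evaluation of a polynomial matrix at `1`. -/
def evalOne : Matrix n n K[X] →+* Matrix n n K := (evalRingHom (1 : K)).mapMatrix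

theorem evalOne_map_C (A : Matrix n n K) : evalOne (A.map C) = A := by
  ext i j
  simp [evalOne]

theorem evalOne_shiftFactor (N : Matrix n n K) (k : ℕ) : evalOne (shiftFactor N k) = 1 := by
  have h : evalOne ((X : K[X]) ^ k • N.map C) = N := by
    ext i j
    simp [evalOne]
  rw [shiftFactor, map_add, map_sub, map_one, h, evalOne_map_C, sub_add_cancel]

theorem evalOne_list_prod {ι : Type*} (l : List ι) (f : ι → Matrix n n K) (k : ι → ℕ) :
    evalOne (l.map fun p => shiftFactor (f p) (k p)).prod = 1 := by
  induction l with
  | nil => simp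
  | cons p l ih => rw [List.map_cons, List.prod_cons, map_mul, ih, evalOne_shiftFactor, one_mul]

/-- A polynomial matrix with unit determinant and value `I` at `1` is a product of factors
`I - N + N X ^ k` with `N ^ 2 = 0`. -/
theorem exists_eq_prod_of_isUnit_det (Q : Matrix n n K[X]) (hQ : IsUnit Q.det)
    (h1 : evalOne Q = 1) :
    ∃ l : List (Matrix n n K × ℕ), (∀ p ∈ l, p.1 ^ 2 = 0 ∧ 0 < p.2) ∧
      Q = (l.map fun p => shiftFactor p.1 p.2).prod := by
  obtain ⟨l, hl, U, hU⟩ := isNilProduct_of_isUnit_det Q hQ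
  refine ⟨l, hl, ?_⟩
  rw [hU, map_mul, evalOne_list_prod l Prod.fst Prod.snd, one_mul, evalOne_map_C] at h1
  rw [hU, h1, map_C_one, mul_one]

/-! ### Splitting off rank-one factors from a matrix with monomial determinant -/

theorem det_shiftFactor_vecMulVec (a w : n → K) (h : w ⬝ᵥ a = 1) :
    (shiftFactor (Matrix.vecMulVec a w) 1).det = X := by
  -- A rank-one update of `I`, so its determinant is `1 + (X - 1) (w ⬝ᵥ a)`.
  have h1 : shiftFactor (Matrix.vecMulVec a w) 1 =
      1 + Matrix.replicateCol Unit (fun i => (X - 1) * C (a i)) *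
        Matrix.replicateRow Unit (fun i => C (w i)) := by
    rw [shiftFactor, sub_add_eq_add_sub, add_sub_assoc]
    congr 1
    ext1 i j
    simp [Matrix.vecMulVec_apply, Matrix.mul_apply]
    ring
  rw [h1, Matrix.det_one_add_replicateCol_mul_replicateRow]
  have h2 : ((fun i => C (w i)) ⬝ᵥ fun i => (X - 1) * C (a i)) = (X - 1) * C (w ⬝ᵥ a) := by
    simp only [dotProduct, map_sum, Finset.mul_sum, C_mul]
    exact Finset.sum_congr rfl fun i _ => by ring
  rw [h2, h]
  simp

/-- With `W = a wᵀ` idempotent and `W P(0) = 0`, the component `W P` is divisible by `X`, namely `W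
P = X W D`. Replacing it by `W D` gives the cofactor `P - W P + W D`, whose degree is no larger
since `D` comes from `P` by removing the constant term and dividing by `X`. -/
theorem exists_shiftFactor_mul (P : Matrix n n K[X]) (a w : n → K) (ha : w ⬝ᵥ a = 1)
    (hw : w ᵥ* (Matrix.of fun i j => (P i j).coeff 0) = 0) (N : ℕ)
    (hN : ∀ i j, (P i j).natDegree ≤ N) :
    ∃ P' : Matrix n n K[X], (∀ i j, (P' i j).natDegree ≤ N) ∧
      P = shiftFactor (Matrix.vecMulVec a w) 1 * P' := by
  set W := (Matrix.vecMulVec a w).map (C : K →+* K[X]) with hW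
  set D : Matrix n n K[X] := Matrix.of fun i j => (P i j).divX with hD
  have hWW : W * W = W := by
    rw [hW, ← map_C_mul, Matrix.vecMulVec_mul_vecMulVec, ha]
    simp
  have hWP : W * P = (X : K[X]) • (W * D) := by
    have hP : P = (X : K[X]) • D + (Matrix.of fun i j => (P i j).coeff 0).map C := by
      ext1 i j
      simp [hD, X_mul_divX_add]
    have h0 : W * (Matrix.of fun i j => (P i j).coeff 0).map C = 0 := by
      rw [hW, ← map_C_mul, Matrix.vecMulVec_mul, hw]
      ext1 i j
      simp
    conv_lhs => rw [hP]
    rw [mul_add, h0, add_zero, Matrix.mul_smul]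
  have hdegmul : ∀ (A : Matrix n n K) (B : Matrix n n K[X]), (∀ i j, (B i j).natDegree ≤ N) →
      ∀ i j, ((A.map C * B) i j).natDegree ≤ N := fun A B hB i j => by
    rw [Matrix.mul_apply]
    exact natDegree_sum_le_of_forall_le _ _ fun l _ => (natDegree_C_mul_le _ _).trans (hB l j)
  refine ⟨P - W * P + W * D, fun i j => ?_, ?_⟩
  · refine natDegree_add_le_of_degree_le ((natDegree_sub_le _ _).trans (max_le (hN i j) ?_)) ?_
    · exact hdegmul _ _ hN i j
    · refine hdegmul _ _ (fun i j => ?_) i j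
      simp only [Matrix.of_apply, natDegree_divX_eq_natDegree_tsub_one]
      exact (Nat.sub_le _ _).trans (hN i j)
  · rw [shiftFactor, ← hW, pow_one]
    have h1 : W * (P - W * P + W * D) = W * D := by
      rw [mul_add, mul_sub, ← mul_assoc, ← mul_assoc, hWW, sub_self, zero_add]
    rw [add_mul, sub_mul, one_mul, Matrix.smul_mul, h1, ← hWP]
    abel

/-- Extraction of `d` factors `I - W + W X` with `W` of rank one from a polynomial matrix whose
determinant is `c X ^ d`. -/
theorem exists_eq_prod_shiftFactor_mul (T : Matrix n n K → Prop)
    (hT : ∀ w : n → K, w ≠ 0 → ∃ a, w ⬝ᵥ a = 1 ∧ T (Matrix.vecMulVec a w)) (N : ℕ)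
    (c : K) (hc : c ≠ 0) (d : ℕ) : ∀ (P : Matrix n n K[X]), P.det = C c * X ^ d →
      (∀ i j, (P i j).natDegree ≤ N) →
      ∃ l : List (Matrix n n K), l.length = d ∧ (∀ W ∈ l, T W) ∧
        ∃ Q : Matrix n n K[X], IsUnit Q.det ∧ (∀ i j, (Q i j).natDegree ≤ N) ∧
          P = (l.map fun W => shiftFactor W 1).prod * Q := by
  induction d with
  | zero =>
    intro P hP hN
    refine ⟨[], rfl, by simp, P, ?_, hN, by simp⟩
    rw [hP, pow_zero, mul_one]
    exact isUnit_C.2 hc.isUnit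
  | succ d ih =>
    intro P hP hN
    have hdet : (Matrix.of fun i j => (P i j).coeff 0).det = 0 := by
      have h : (Matrix.of fun i j => (P i j).coeff 0) = (evalRingHom (0 : K)).mapMatrix P := by
        ext i j
        simp [coeff_zero_eq_eval_zero]
      rw [h, ← RingHom.map_det, hP]
      simp
    obtain ⟨w, hw0, hw⟩ := Matrix.exists_vecMul_eq_zero_iff.2 hdet
    obtain ⟨a, ha, hTa⟩ := hT w hw0
    obtain ⟨P', hN', hP'⟩ := exists_shiftFactor_mul P a w ha hw N hN
    have hdet' : P'.det = C c * X ^ d := by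
      have h := hP
      rw [hP', Matrix.det_mul, det_shiftFactor_vecMulVec a w ha, pow_succ', mul_left_comm] at h
      exact mul_left_cancel₀ X_ne_zero h
    obtain ⟨l, hlen, hl, Q, hQ, hQN, hPQ⟩ := ih P' hdet' hN'
    refine ⟨Matrix.vecMulVec a w :: l, by simp [hlen], ?_, Q, hQ, hQN, ?_⟩
    · simpa using ⟨hTa, hl⟩
    · rw [hP', hPQ, List.map_cons, List.prod_cons, mul_assoc]

end PolynomialMatrix

/-! ### The adjoint and the inverses of the factors -/

section Adjoint

variable {m : ℕ}

/-- Complex conjugation of the coefficients together with `z ↦ z⁻¹`. -/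
def conjInvert : ℂ[T;T⁻¹] →+* ℂ[T;T⁻¹] :=
  (LaurentPolynomial.invert (R := ℂ) : ℂ[T;T⁻¹] →+* ℂ[T;T⁻¹]).comp
    (AddMonoidAlgebra.mapRingHom ℤ (starRingEnd ℂ))

theorem coeff_conjInvert (f : ℂ[T;T⁻¹]) (n : ℤ) :
    (conjInvert f).coeff n = starRingEnd ℂ (f.coeff (-n)) := by
  simp [conjInvert]

theorem conjInvert_conjInvert (f : ℂ[T;T⁻¹]) : conjInvert (conjInvert f) = f := by
  ext n
  simp [coeff_conjInvert]

theorem conjInvert_C (a : ℂ) :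
    conjInvert (LaurentPolynomial.C a) = LaurentPolynomial.C (starRingEnd ℂ a) := by
  ext n
  simp [coeff_conjInvert, apply_ite (starRingEnd ℂ)]

theorem conjInvert_zPow (n : ℤ) : conjInvert (zPow n) = zPow (-n) := by
  ext k
  simp [coeff_conjInvert, zPow, apply_ite (starRingEnd ℂ), eq_neg_iff_add_eq_zero,
    neg_eq_iff_add_eq_zero]

theorem adj_apply (A : LMat m) (i j : Fin m) : adj A i j = conjInvert (A j i) := rfl

theorem adj_eq (A : LMat m) : adj A = (conjInvert.mapMatrix A)ᵀ := rfl

theorem adj_mul (A B : LMat m) : adj (A * B) = adj B * adj A := by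
  simp only [adj_eq, map_mul, Matrix.transpose_mul]

theorem adj_one : adj (1 : LMat m) = 1 := by
  simp only [adj_eq, map_one, Matrix.transpose_one]

theorem adj_add (A B : LMat m) : adj (A + B) = adj A + adj B := by
  simp only [adj_eq, map_add, Matrix.transpose_add]

theorem adj_sub (A B : LMat m) : adj (A - B) = adj A - adj B := by
  simp only [adj_eq, map_sub, Matrix.transpose_sub]

theorem adj_smul (n : ℤ) (A : LMat m) : adj (zPow n • A) = zPow (-n) • adj A := by
  ext1 i j
  simp [adj_apply, conjInvert_zPow]

theorem adj_adj (A : LMat m) : adj (adj A) = A := by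
  ext1 i j
  simp [adj_apply, conjInvert_conjInvert]

theorem adj_const (A : Matrix (Fin m) (Fin m) ℂ) : adj (const A) = const Aᴴ := by
  ext1 i j
  simp [adj_apply, const, conjInvert_C]

theorem const_mul (A B : Matrix (Fin m) (Fin m) ℂ) : const (A * B) = const A * const B :=
  Matrix.map_mul

theorem const_one : const (1 : Matrix (Fin m) (Fin m) ℂ) = 1 :=
  Matrix.map_one _ (map_zero _) (map_one _)

theorem const_zero : const (0 : Matrix (Fin m) (Fin m) ℂ) = 0 :=
  Matrix.map_zero _ (map_zero _)

theorem zPow_mul_zPow_neg (n : ℤ) : zPow n * zPow (-n) = 1 := by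
  rw [zPow, zPow, ← LaurentPolynomial.T_add, add_neg_cancel, LaurentPolynomial.T_zero]

theorem primitiveParaunitary_mul_adj (v : Fin m → ℂ) (hv : IsUnitVector v) :
    primitiveParaunitary v * adj (primitiveParaunitary v) = 1 := by
  have hstar : (Matrix.vecMulVec v (star v))ᴴ = Matrix.vecMulVec v (star v) := by
    rw [Matrix.conjTranspose_vecMulVec, star_star]
  have hWW : const (Matrix.vecMulVec v (star v)) * const (Matrix.vecMulVec v (star v)) =
      const (Matrix.vecMulVec v (star v)) := by
    rw [← const_mul, Matrix.vecMulVec_mul_vecMulVec, hv]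
    simp
  rw [primitiveParaunitary, adj_add, adj_sub, adj_one, adj_smul, adj_const, hstar]
  simp only [add_mul, sub_mul, mul_add, mul_sub, one_mul, mul_one, Matrix.smul_mul,
    Matrix.mul_smul, hWW, smul_smul, zPow_mul_zPow_neg, mul_comm (zPow (- -1)), one_smul]
  abel

theorem leftFactor_mul_adj_rightFactor (N : Matrix (Fin m) (Fin m) ℂ) (hN : N ^ 2 = 0) (k : ℕ) :
    leftFactor N k * adj (rightFactor N k) = 1 := by
  have h0 : const N * const N = 0 := by
    rw [← const_mul, ← sq, hN, const_zero]
  rw [leftFactor, rightFactor, adj_sub, adj_add, adj_one, adj_smul, adj_const,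
    Matrix.conjTranspose_conjTranspose]
  simp only [add_mul, sub_mul, mul_add, mul_sub, one_mul, mul_one, Matrix.smul_mul,
    Matrix.mul_smul, h0, smul_zero]
  abel

theorem list_prod_mul_adj {ι : Type*} (l : List ι) (f g : ι → LMat m)
    (h : ∀ x ∈ l, f x * adj (g x) = 1) : (l.map f).prod * adj (l.map g).prod = 1 := by
  induction l with
  | nil => simp [adj_one]
  | cons a l ih =>
    have ha := h a (by simp)
    have hl := ih fun x hx => h x (by simp [hx])
    rw [List.map_cons, List.map_cons, List.prod_cons, List.prod_cons, adj_mul, mul_assoc,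
      ← mul_assoc _ (adj _) (adj _), hl, one_mul, ha]

theorem ofFn_reverse {α : Type*} {r : ℕ} (f : Fin r → α) :
    (List.ofFn f).reverse = (List.finRange r).reverse.map f := by
  rw [List.ofFn_eq_map, List.map_reverse]

end Adjoint

/-! ### Evaluation at `z = 1` and row sums -/

section Evaluation

variable {m : ℕ}

/-- The value of a Laurent polynomial at `z = 1`. -/
def evalLaurent : ℂ[T;T⁻¹] →+* ℂ := LaurentPolynomial.eval₂ (RingHom.id ℂ) 1

theorem evalLaurent_C_mul_T (a : ℂ) (n : ℤ) :
    evalLaurent (LaurentPolynomial.C a * LaurentPolynomial.T n) = a := by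
  simp [evalLaurent]

theorem evalLaurent_C (a : ℂ) : evalLaurent (LaurentPolynomial.C a) = a := by
  simp [evalLaurent]

theorem evalLaurent_zPow (n : ℤ) : evalLaurent (zPow n) = 1 := by
  simp [evalLaurent, zPow]

theorem evalLaurent_eq_sum (f : ℂ[T;T⁻¹]) : evalLaurent f = f.coeff.sum fun _ a => a := by
  induction f using LaurentPolynomial.induction_on' with
  | add p q hp hq =>
    rw [map_add, hp, hq, AddMonoidAlgebra.coeff_add, Finsupp.sum_add_index'] <;> simp
  | C_mul_T n a =>
    rw [evalLaurent_C_mul_T, ← LaurentPolynomial.single_eq_C_mul_T, AddMonoidAlgebra.coeff_single,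
      Finsupp.sum_single_index rfl]

theorem evalLaurent_conjInvert (f : ℂ[T;T⁻¹]) :
    evalLaurent (conjInvert f) = starRingEnd ℂ (evalLaurent f) := by
  induction f using LaurentPolynomial.induction_on' with
  | add p q hp hq => simp only [map_add, hp, hq]
  | C_mul_T n a =>
    have h : conjInvert (LaurentPolynomial.T n) = LaurentPolynomial.T (-n) := conjInvert_zPow n
    rw [map_mul, conjInvert_C, h, evalLaurent_C_mul_T, evalLaurent_C_mul_T]

/-- The value of a matrix of Laurent polynomials at `z = 1`. -/
def atOne : LMat m →+* Matrix (Fin m) (Fin m) ℂ := evalLaurent.mapMatrix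

theorem atOne_adj (A : LMat m) : atOne (adj A) = (atOne A)ᴴ := by
  ext i j
  simp [atOne, adj_apply, evalLaurent_conjInvert]

theorem atOne_smul (n : ℤ) (A : LMat m) : atOne (zPow n • A) = atOne A := by
  ext i j
  simp [atOne, evalLaurent_zPow]

theorem atOne_const (A : Matrix (Fin m) (Fin m) ℂ) : atOne (const A) = A := by
  ext i j
  simp [atOne, const, evalLaurent_C]

theorem rowSum_eq (A : LMat m) (i : Fin m) : rowSum A i = ∑ j, atOne A i j := by
  rw [rowSum, Finset.sum_comm]
  refine Finset.sum_congr rfl fun j _ => ?_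
  change _ = evalLaurent (A i j)
  -- The support of the single entry is enlarged to the index set common to all entries; the sign
  -- appears because block `k` holds the coefficients of `z ^ (-k)`.
  rw [evalLaurent_eq_sum, Finsupp.sum_of_support_subset (s := (blockSupport A).image fun k => -k),
    Finset.sum_image (by simp)]
  · rfl
  · intro n hn
    simp only [Finset.mem_image]
    refine ⟨-n, ?_, by simp⟩
    rw [mem_blockSupport]
    intro h0
    have := congrFun (congrFun h0 i) j
    simp only [block, Matrix.of_apply, neg_neg, Matrix.zero_apply] at this
    exact (Finsupp.mem_support_iff.1 hn) this
  · simp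

theorem atOne_primitiveParaunitary (v : Fin m → ℂ) : atOne (primitiveParaunitary v) = 1 := by
  rw [primitiveParaunitary, map_add, map_sub, map_one, atOne_smul, atOne_const, sub_add_cancel]

theorem atOne_leftFactor (N : Matrix (Fin m) (Fin m) ℂ) (k : ℕ) : atOne (leftFactor N k) = 1 := by
  rw [leftFactor, map_add, map_sub, map_one, atOne_smul, atOne_const, sub_add_cancel]

theorem atOne_rightFactor (N : Matrix (Fin m) (Fin m) ℂ) (k : ℕ) :
    atOne (rightFactor N k) = 1 := by
  rw [rightFactor, map_sub, map_add, map_one, atOne_smul, atOne_const, add_sub_cancel_right]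

theorem atOne_list_prod (l : List (LMat m)) (h : ∀ A ∈ l, atOne A = 1) : atOne l.prod = 1 := by
  rw [map_list_prod]
  exact List.prod_eq_one fun x hx => by
    obtain ⟨A, hA, rfl⟩ := List.mem_map.1 hx
    exact h A hA

end Evaluation

/-! ### Orthogonality of the canonical Haar matrix -/

section Haar

variable {m : ℕ}

theorem canonicalHaar_zero {i : Fin m} (hi : (i : ℕ) = 0) (j : Fin m) :
    canonicalHaar m i j = 1 := by
  simp [canonicalHaar, hi]

theorem canonicalHaar_of_lt {i j : Fin m} (h : (j : ℕ) + 1 < (i : ℕ)) :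
    canonicalHaar m i j = 0 := by
  have hi : (i : ℕ) ≠ 0 := by omega
  simp [canonicalHaar, hi, h]

theorem canonicalHaar_of_eq {i j : Fin m} (h : (j : ℕ) + 1 = (i : ℕ)) :
    canonicalHaar m i j = -((m : ℂ) - (i : ℕ)) *
      (√((m : ℝ) / (((m : ℝ) - (i : ℕ)) ^ 2 + ((m : ℝ) - (i : ℕ)))) : ℝ) := by
  have hi : (i : ℕ) ≠ 0 := by omega
  simp [canonicalHaar, hi, h]

theorem canonicalHaar_of_le {i j : Fin m} (hi : (i : ℕ) ≠ 0) (h : (i : ℕ) ≤ (j : ℕ)) :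
    canonicalHaar m i j =
      (√((m : ℝ) / (((m : ℝ) - (i : ℕ)) ^ 2 + ((m : ℝ) - (i : ℕ)))) : ℝ) := by
  have h1 : ¬ ((j : ℕ) + 1 < (i : ℕ)) := by omega
  have h2 : ¬ ((j : ℕ) + 1 = (i : ℕ)) := by omega
  simp [canonicalHaar, hi, h1, h2]

/-- A sum over a row of shape `(0, …, 0, a, b, …, b)` with `i - 1` zeros. -/
theorem sum_row_shape (i : Fin m) (hi : (i : ℕ) ≠ 0) (f : Fin m → ℂ) (a b : ℂ)
    (h0 : ∀ j : Fin m, (j : ℕ) + 1 < i → f j = 0) (h1 : ∀ j : Fin m, (j : ℕ) + 1 = i → f j = a)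
    (h2 : ∀ j : Fin m, (i : ℕ) ≤ j → f j = b) :
    ∑ j, f j = a + ((m : ℂ) - (i : ℕ)) * b := by
  let p : Fin m := ⟨(i : ℕ) - 1, by omega⟩
  have hf : ∀ j, f j = (if j = p then a else 0) + if i ≤ j then b else 0 := by
    intro j
    rcases lt_trichotomy ((j : ℕ) + 1) i with h | h | h
    · have hp : j ≠ p := fun hh => by rw [hh] at h; simp only [p] at h; omega
      have hij : ¬ i ≤ j := fun hh => by rw [Fin.le_def] at hh; omega
      simp [h0 j h, hp, hij]
    · have hp : j = p := Fin.ext (by simp only [p]; omega)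
      have hij : ¬ i ≤ j := fun hh => by rw [Fin.le_def] at hh; omega
      rw [h1 j h, if_pos hp, if_neg hij, add_zero]
    · have hp : j ≠ p := fun hh => by rw [hh] at h; simp only [p] at h; omega
      have hij : i ≤ j := by rw [Fin.le_def]; omega
      rw [h2 j (by omega), if_neg hp, if_pos hij, zero_add]
  simp only [hf, Finset.sum_add_distrib, Finset.sum_ite_eq', Finset.mem_univ, if_true]
  rw [← Finset.sum_filter, Finset.sum_const, Finset.filter_le_eq_Ici, Fin.card_Ici, nsmul_eq_mul,
    Nat.cast_sub i.2.le]

theorem sum_canonicalHaar (i : Fin m) :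
    ∑ j, canonicalHaar m i j = if (i : ℕ) = 0 then (m : ℂ) else 0 := by
  split_ifs with hi
  · simp [canonicalHaar_zero hi]
  · rw [sum_row_shape i hi _ _ _ (fun j h => canonicalHaar_of_lt h)
      (fun j h => canonicalHaar_of_eq h) (fun j h => canonicalHaar_of_le hi h)]
    ring

theorem star_canonicalHaar (i j : Fin m) : star (canonicalHaar m i j) = canonicalHaar m i j := by
  simp only [canonicalHaar, Matrix.of_apply]
  split_ifs <;> simp

/-- The earlier row is constant on the positions where the later one can be nonzero, and the later
one has sum zero. -/
theorem canonicalHaar_row_mul_of_lt {i j : Fin m} (h : i < j) :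
    ∑ k, canonicalHaar m i k * canonicalHaar m j k = 0 := by
  have hj : (j : ℕ) ≠ 0 := by rw [Fin.lt_def] at h; omega
  have hsum := sum_canonicalHaar j
  rw [if_neg hj] at hsum
  obtain ⟨c, hc⟩ : ∃ c : ℂ, ∀ k : Fin m, (j : ℕ) ≤ (k : ℕ) + 1 → canonicalHaar m i k = c := by
    by_cases hi : (i : ℕ) = 0
    · exact ⟨1, fun k _ => canonicalHaar_zero hi k⟩
    · exact ⟨_, fun k hk => canonicalHaar_of_le hi (by rw [Fin.lt_def] at h; omega)⟩
  have : ∀ k, canonicalHaar m i k * canonicalHaar m j k = c * canonicalHaar m j k := by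
    intro k
    rcases Nat.lt_or_ge ((k : ℕ) + 1) j with hk | hk
    · rw [canonicalHaar_of_lt hk, mul_zero, mul_zero]
    · rw [hc k hk]
  simp only [this]
  rw [← Finset.mul_sum, hsum, mul_zero]

theorem canonicalHaar_row_mul_self (i : Fin m) :
    ∑ k, canonicalHaar m i k * canonicalHaar m i k = m := by
  by_cases hi : (i : ℕ) = 0
  · simp [canonicalHaar_zero hi]
  · have hs : (0 : ℝ) < (m : ℝ) - (i : ℕ) := by
      have := i.2
      rw [sub_pos]
      exact_mod_cast this
    set s : ℝ := (m : ℝ) - (i : ℕ) with hsdef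
    have hsq : ((√((m : ℝ) / (s ^ 2 + s)) : ℝ) : ℂ) * (√((m : ℝ) / (s ^ 2 + s)) : ℝ) =
        (((m : ℝ) / (s ^ 2 + s) : ℝ) : ℂ) := by
      rw [← Complex.ofReal_mul, Real.mul_self_sqrt (by positivity)]
    have hsc : (m : ℂ) - (i : ℕ) = (s : ℂ) := by simp [hsdef]
    -- The entry `-s` contributes `s ^ 2` and the `s` ones contribute `s`, each multiplied by `m /
    -- (s ^ 2 + s)`.
    rw [sum_row_shape i hi _ (s * s * (((m : ℝ) / (s ^ 2 + s) : ℝ) : ℂ))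
      (((m : ℝ) / (s ^ 2 + s) : ℝ) : ℂ)]
    · rw [hsc]
      norm_cast
      field_simp
    · intro j h
      rw [canonicalHaar_of_lt h, mul_zero]
    · intro j h
      rw [canonicalHaar_of_eq h, hsc, ← hsdef, ← hsq]
      ring
    · intro j h
      rw [canonicalHaar_of_le hi h, ← hsdef, hsq]

theorem canonicalHaar_mul_conjTranspose :
    canonicalHaar m * (canonicalHaar m)ᴴ = (m : ℂ) • (1 : Matrix (Fin m) (Fin m) ℂ) := by
  ext i j
  simp only [Matrix.mul_apply, Matrix.conjTranspose_apply, star_canonicalHaar, Matrix.smul_apply,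
    Matrix.one_apply, smul_eq_mul]
  rcases lt_trichotomy i j with h | rfl | h
  · rw [canonicalHaar_row_mul_of_lt h, if_neg h.ne, mul_zero]
  · rw [canonicalHaar_row_mul_self, if_pos rfl, mul_one]
  · simp only [mul_comm (canonicalHaar m i _)]
    rw [canonicalHaar_row_mul_of_lt h, if_neg h.ne', mul_zero]

end Haar

/-! ### Block diagonal matrices `diag(1, G)` -/

section DiagOne

theorem diagOne_mul {m : ℕ} (A B : Matrix (Fin (m - 1)) (Fin (m - 1)) ℂ) :
    diagOne (m := m) A * diagOne B = diagOne (A * B) := by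
  cases m with
  | zero => exact Subsingleton.elim _ _
  | succ n =>
    ext i j
    rw [Matrix.mul_apply, Fin.sum_univ_succ]
    refine Fin.cases ?_ (fun i => ?_) i <;> refine Fin.cases ?_ (fun j => ?_) j <;>
      simp [diagOne, Matrix.mul_apply]

theorem diagOne_one {m : ℕ} : diagOne (m := m) 1 = 1 := by
  ext i j
  simp only [diagOne, Matrix.of_apply, Matrix.one_apply, Fin.ext_iff]
  split_ifs <;> first | rfl | omega

theorem diagOne_conjTranspose {m : ℕ} (A : Matrix (Fin (m - 1)) (Fin (m - 1)) ℂ) :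
    (diagOne (m := m) A)ᴴ = diagOne Aᴴ := by
  ext i j
  simp only [diagOne, Matrix.conjTranspose_apply, Matrix.of_apply]
  split_ifs <;> simp

theorem sum_diagOne_mul {m : ℕ} (A : Matrix (Fin (m - 1)) (Fin (m - 1)) ℂ)
    (H : Matrix (Fin m) (Fin m) ℂ)
    (hH : ∀ i, ∑ j, H i j = if (i : ℕ) = 0 then (m : ℂ) else 0) (i : Fin m) :
    ∑ j, (diagOne A * H) i j = if (i : ℕ) = 0 then (m : ℂ) else 0 := by
  cases m with
  | zero => exact i.elim0
  | succ n =>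
    simp only [Matrix.mul_apply]
    rw [Finset.sum_comm]
    simp only [← Finset.mul_sum, hH]
    rw [Fin.sum_univ_succ]
    refine Fin.cases ?_ (fun i => ?_) i <;> simp [diagOne]

/-- The lower right block of a matrix of size `m`. -/
def lowerBlock {R : Type*} {m : ℕ} (A : Matrix (Fin m) (Fin m) R) :
    Matrix (Fin (m - 1)) (Fin (m - 1)) R :=
  Matrix.of fun i j => A ⟨i + 1, by omega⟩ ⟨j + 1, by omega⟩

theorem diagOne_lowerBlock {m : ℕ} (A : Matrix (Fin m) (Fin m) ℂ)
    (hrow : ∀ i j : Fin m, (i : ℕ) = 0 → A i j = if (j : ℕ) = 0 then 1 else 0)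
    (hcol : ∀ i j : Fin m, (j : ℕ) = 0 → A i j = if (i : ℕ) = 0 then 1 else 0) :
    diagOne (lowerBlock A) = A := by
  ext i j
  simp only [diagOne, Matrix.of_apply]
  split_ifs with hi hj hj
  · rw [hrow i j hi, if_pos hj]
  · rw [hrow i j hi, if_neg hj]
  · rw [hcol i j hj, if_neg hi]
  · simp only [lowerBlock, Matrix.of_apply]
    congr 2 <;> omega

end DiagOne

/-! ### Factored pairs are biorthogonal wavelet pairs -/

section Sufficiency

variable {m : ℕ}

theorem natCast_smul_one_eq_const :
    (m : ℂ[T;T⁻¹]) • (1 : LMat m) = const ((m : ℂ) • (1 : Matrix (Fin m) (Fin m) ℂ)) := by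
  ext1 i j
  by_cases h : i = j <;> simp [const, h]

theorem mul_adj_of_factors (k₀ : ℤ) (V A B : LMat m) (D E H : Matrix (Fin m) (Fin m) ℂ)
    (hV : V * adj V = 1) (hAB : A * adj B = 1) (hDE : D * Eᴴ = 1)
    (hH : H * Hᴴ = (m : ℂ) • (1 : Matrix (Fin m) (Fin m) ℂ)) :
    (zPow (-k₀) • (V * A * const D * const H)) * adj (zPow (-k₀) • (V * B * const E * const H)) =
      (m : ℂ[T;T⁻¹]) • (1 : LMat m) := by
  have hHc : const H * const Hᴴ = (m : ℂ[T;T⁻¹]) • (1 : LMat m) := by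
    rw [← const_mul, hH, natCast_smul_one_eq_const]
  have hDc : const D * const Eᴴ = 1 := by rw [← const_mul, hDE, const_one]
  rw [adj_smul, Matrix.smul_mul, Matrix.mul_smul, smul_smul, zPow_mul_zPow_neg, one_smul]
  simp only [adj_mul, adj_const]
  calc V * A * const D * const H * (const Hᴴ * (const Eᴴ * (adj B * adj V)))
      = V * A * const D * (const H * const Hᴴ) * (const Eᴴ * (adj B * adj V)) := by
        simp only [mul_assoc]
    _ = (m : ℂ[T;T⁻¹]) • (V * (A * (const D * const Eᴴ) * adj B) * adj V) := by
        rw [hHc, Matrix.mul_smul, Matrix.smul_mul, mul_one]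
        simp only [mul_assoc]
    _ = (m : ℂ[T;T⁻¹]) • (1 : LMat m) := by rw [hDc, mul_one, hAB, mul_one, hV]

theorem rowSum_of_factors (k₀ : ℤ) (V A : LMat m) (hV : atOne V = 1) (hA : atOne A = 1)
    (D : Matrix (Fin (m - 1)) (Fin (m - 1)) ℂ) (i : Fin m) :
    rowSum (zPow (-k₀) • (V * A * const (diagOne D) * const (canonicalHaar m))) i =
      if (i : ℕ) = 0 then (m : ℂ) else 0 := by
  rw [rowSum_eq, atOne_smul, map_mul, map_mul, map_mul, hV, hA, one_mul, one_mul, atOne_const,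
    atOne_const]
  exact sum_diagOne_mul D _ sum_canonicalHaar i

theorem map_subtype_mul_inv (F : Subfield ℂ) {n : ℕ} (G : Matrix.GeneralLinearGroup (Fin n) F) :
    (G : Matrix (Fin n) (Fin n) F).map F.subtype *
      ((G⁻¹ : Matrix.GeneralLinearGroup (Fin n) F) : Matrix (Fin n) (Fin n) F).map F.subtype
        = 1 := by
  rw [← Matrix.map_mul, Units.mul_inv, Matrix.map_one _ (map_zero _) (map_one _)]

theorem diagOne_mul_conjTranspose (F : Subfield ℂ)
    (G : Matrix.GeneralLinearGroup (Fin (m - 1)) F) :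
    diagOne (m := m) ((G : Matrix (Fin (m - 1)) (Fin (m - 1)) F).map F.subtype) *
      (diagOne (m := m) (((G⁻¹ : Matrix.GeneralLinearGroup (Fin (m - 1)) F) :
            Matrix (Fin (m - 1)) (Fin (m - 1)) F).map F.subtype)ᴴ)ᴴ = 1 := by
  rw [diagOne_conjTranspose, Matrix.conjTranspose_conjTranspose, diagOne_mul,
    map_subtype_mul_inv, diagOne_one]

theorem paraunitary_prod_mul_adj {d : ℕ} (v : Fin d → Fin m → ℂ)
    (hv : ∀ s, IsUnitVector (v s)) :
    (List.ofFn fun s => primitiveParaunitary (v s)).prod *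
      adj (List.ofFn fun s => primitiveParaunitary (v s)).prod = 1 := by
  rw [List.ofFn_eq_map]
  exact list_prod_mul_adj _ _ _ fun s _ => primitiveParaunitary_mul_adj _ (hv s)

theorem left_prod_mul_adj_right_prod {r : ℕ} (N : Fin r → Matrix (Fin m) (Fin m) ℂ)
    (hN : ∀ i, N i ^ 2 = 0) (k : Fin r → ℕ) :
    (List.ofFn fun i => leftFactor (N i) (k i)).reverse.prod *
      adj (List.ofFn fun i => rightFactor (N i) (k i)).reverse.prod = 1 := by
  rw [ofFn_reverse, ofFn_reverse]
  exact list_prod_mul_adj _ _ _ fun i _ => leftFactor_mul_adj_rightFactor _ (hN i) _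

theorem map_subtype_sq (F : Subfield ℂ) {N : Matrix (Fin m) (Fin m) F} (h : N ^ 2 = 0) :
    (N.map F.subtype) ^ 2 = 0 := by
  rw [sq, ← Matrix.map_mul, ← sq, h, Matrix.map_zero _ (map_zero _)]

theorem HasFactorization.isBiorthogonalWaveletPair {F K : Subfield ℂ} {g : ℕ} {L R : LMat m}
    (h : HasFactorization F K g L R) : IsBiorthogonalWaveletPair L R := by
  obtain ⟨k₀, b, d, r, v, N, k, G, -, -, hv, -, -, -, hN, -, -, rfl, rfl⟩ := h
  have hV : atOne (List.ofFn fun s => primitiveParaunitary (v s)).prod = 1 :=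
    atOne_list_prod _ fun A hA => by
      obtain ⟨s, rfl⟩ := List.mem_ofFn.1 hA
      exact atOne_primitiveParaunitary _
  refine ⟨?_, ?_, ?_⟩
  · exact mul_adj_of_factors k₀ _ _ _ _ _ _ (paraunitary_prod_mul_adj v hv)
      (left_prod_mul_adj_right_prod _ (fun i => map_subtype_sq F (hN i)) k)
      (diagOne_mul_conjTranspose F G) canonicalHaar_mul_conjTranspose
  · refine rowSum_of_factors k₀ _ _ hV (atOne_list_prod _ fun A hA => ?_) _
    obtain ⟨s, rfl⟩ := List.mem_ofFn.1 (List.mem_reverse.1 hA)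
    exact atOne_leftFactor _ _
  · refine rowSum_of_factors k₀ _ _ hV (atOne_list_prod _ fun A hA => ?_) _
    obtain ⟨s, rfl⟩ := List.mem_ofFn.1 (List.mem_reverse.1 hA)
    exact atOne_rightFactor _ _

/-- The left partner determines the right partner. -/
theorem eq_of_mul_adj_eq (hm : m ≠ 0) {L R R' : LMat m}
    (h : L * adj R = (m : ℂ[T;T⁻¹]) • (1 : LMat m))
    (h' : L * adj R' = (m : ℂ[T;T⁻¹]) • (1 : LMat m)) : R = R' := by
  have hc : (LaurentPolynomial.C ((m : ℂ)⁻¹) : ℂ[T;T⁻¹]) * (m : ℂ[T;T⁻¹]) = 1 := by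
    rw [← map_natCast (LaurentPolynomial.C (R := ℂ)), ← map_mul,
      inv_mul_cancel₀ (Nat.cast_ne_zero.2 hm), map_one]
  have h1 : (LaurentPolynomial.C ((m : ℂ)⁻¹) : ℂ[T;T⁻¹]) • adj R * L = 1 := by
    -- A one-sided inverse of a square matrix over a commutative ring is two-sided, so `L` can be
    -- cancelled on the left.
    rw [mul_eq_one_comm, Matrix.mul_smul, h, smul_smul, hc, one_smul]
  have h2 : adj R = adj R' := by
    have := congrArg (fun A => (LaurentPolynomial.C ((m : ℂ)⁻¹) : ℂ[T;T⁻¹]) • adj R * A)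
      (h.trans h'.symm)
    simpa only [← mul_assoc, h1, one_mul] using this
  rw [← adj_adj R, h2, adj_adj]

end Sufficiency

/-! ### Passage between `F[X]` and Laurent polynomials, with `X = z⁻¹` -/

section Embedding

open Polynomial

variable (F : Subfield ℂ)

/-- The embedding `F[X] → ℂ[z, z⁻¹]` with `X ↦ z⁻¹`. -/
def embed : F[X] →+* ℂ[T;T⁻¹] :=
  ((LaurentPolynomial.invert (R := ℂ) : ℂ[T;T⁻¹] →+* ℂ[T;T⁻¹]).comp toLaurent).comp
    (mapRingHom F.subtype)

theorem embed_apply (p : F[X]) :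
    embed F p = LaurentPolynomial.invert (toLaurent (p.map F.subtype)) := rfl

theorem embed_C (a : F) : embed F (C a) = LaurentPolynomial.C (a : ℂ) := by
  simp [embed_apply]

theorem embed_X_pow (k : ℕ) : embed F (X ^ k) = zPow (-(k : ℤ)) := by
  simp [embed_apply, zPow]

theorem coeff_embed_neg_natCast (p : F[X]) (k : ℕ) :
    (embed F p).coeff (-(k : ℤ)) = (p.coeff k : ℂ) := by
  induction p using Polynomial.induction_on' with
  | add p q hp hq => simp [hp, hq]
  | monomial n a =>
    rw [← C_mul_X_pow_eq_monomial, map_mul, embed_C, embed_X_pow, zPow,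
      ← LaurentPolynomial.single_eq_C_mul_T, AddMonoidAlgebra.coeff_single, Finsupp.single_apply,
      coeff_C_mul_X_pow]
    by_cases h : n = k
    · simp [h]
    · simp [h, Ne.symm h]

theorem coeff_embed_of_pos (p : F[X]) {k : ℤ} (hk : 0 < k) : (embed F p).coeff k = 0 := by
  induction p using Polynomial.induction_on' with
  | add p q hp hq => simp [hp, hq]
  | monomial n a =>
    rw [← C_mul_X_pow_eq_monomial, map_mul, embed_C, embed_X_pow, zPow,
      ← LaurentPolynomial.single_eq_C_mul_T, AddMonoidAlgebra.coeff_single, Finsupp.single_apply,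
      if_neg (by omega)]

theorem evalLaurent_embed (p : F[X]) : evalLaurent (embed F p) = (p.eval 1 : F) := by
  induction p using Polynomial.induction_on' with
  | add p q hp hq => simp [hp, hq]
  | monomial n a =>
    rw [← C_mul_X_pow_eq_monomial, map_mul, embed_C, embed_X_pow, zPow, evalLaurent_C_mul_T]
    simp

/-- A polynomial that becomes invertible over `ℂ[z, z⁻¹]` is a monomial. -/
theorem eq_C_mul_X_pow_of_isUnit_embed (p : F[X]) (hp : IsUnit (embed F p)) :
    ∃ (c : F) (d : ℕ), c ≠ 0 ∧ p = C c * X ^ d := by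
  obtain ⟨q, hq⟩ := hp.exists_right_inv
  -- Clearing denominators in the inverse shows that `p` divides `X ^ n` over `ℂ`. Divisibility
  -- descends to `F`, where `X` is prime.
  obtain ⟨n, f, hf⟩ := (LaurentPolynomial.invert q).exists_T_pow
  have h1 : toLaurent (p.map F.subtype) * LaurentPolynomial.invert q = 1 := by
    have := congrArg LaurentPolynomial.invert hq
    rwa [map_mul, map_one, embed_apply, LaurentPolynomial.involutive_invert] at this
  have h2 : p.map F.subtype * f = X ^ n := by
    apply toLaurent_injective
    rw [map_mul, hf, ← mul_assoc, h1, one_mul, toLaurent_X_pow]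
  have h3 : p ∣ X ^ n := by
    rw [← Polynomial.map_dvd_map' F.subtype]
    exact ⟨f, by simp [h2]⟩
  obtain ⟨d, -, hd⟩ := (dvd_prime_pow Polynomial.prime_X n).1 h3
  obtain ⟨u, hu⟩ := hd.symm
  obtain ⟨c, hc, hcu⟩ := Polynomial.isUnit_iff.1 u.isUnit
  exact ⟨c, d, hc.ne_zero, by rw [← hu, ← hcu, mul_comm]⟩

variable {F} {m : ℕ}

theorem embed_shiftFactor (N : Matrix (Fin m) (Fin m) F) (k : ℕ) :
    (embed F).mapMatrix (shiftFactor N k) = leftFactor (N.map F.subtype) k := by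
  ext1 i j
  by_cases h : i = j <;>
    simp [shiftFactor, leftFactor, const, h, embed_C, -map_pow, embed_X_pow] <;>
    exact mul_comm _ _

theorem atOne_embed (P : Matrix (Fin m) (Fin m) F[X]) :
    atOne ((embed F).mapMatrix P) = (evalOne P).map F.subtype := by
  ext i j
  simp [atOne, evalOne, evalLaurent_embed]

theorem embed_map_C (A : Matrix (Fin m) (Fin m) F) :
    (embed F).mapMatrix (A.map C) = const (A.map F.subtype) := by
  ext1 i j
  simp [const, embed_C]

theorem genus_embed_le (P : Matrix (Fin m) (Fin m) F[X]) (n : ℕ)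
    (h : ∀ i j, (P i j).natDegree ≤ n) : genus ((embed F).mapMatrix P) ≤ n + 1 := by
  have hsupp : ∀ k ∈ blockSupport ((embed F).mapMatrix P), 0 ≤ k ∧ k ≤ n := by
    intro k hk
    rw [mem_blockSupport] at hk
    by_contra hcon
    apply hk
    ext i j
    simp only [block, Matrix.of_apply, RingHom.mapMatrix_apply, Matrix.map_apply,
      Matrix.zero_apply]
    rcases lt_or_ge k 0 with hk0 | hk0
    · exact coeff_embed_of_pos F _ (by omega)
    · lift k to ℕ using hk0
      rw [coeff_embed_neg_natCast, coeff_eq_zero_of_natDegree_lt]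
      · simp
      · have := h i j
        omega
  unfold genus
  split_ifs with hne
  · have h1 := hsupp _ ((blockSupport _).max'_mem hne)
    have h2 := hsupp _ ((blockSupport _).min'_mem hne)
    omega
  · omega

theorem exists_eq_zPow_mul_embed (f : F[T;T⁻¹]) (k₀ : ℤ) (n : ℕ)
    (hf : ∀ k, (-k < k₀ ∨ k₀ + n < -k) → f.coeff k = 0) :
    ∃ p : F[X], p.natDegree ≤ n ∧
      AddMonoidAlgebra.mapRingHom ℤ F.subtype f = zPow (-k₀) * embed F p := by
  -- Block indices are the negatives of exponents of `z`: the coefficient of `X ^ l` is the one with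
  -- block index `k₀ + l`.
  refine ⟨∑ l ∈ Finset.range (n + 1), C (f.coeff (-(k₀ + l))) * X ^ l, ?_, ?_⟩
  · refine natDegree_sum_le_of_forall_le _ _ fun l hl => (natDegree_C_mul_X_pow_le _ _).trans ?_
    rw [Finset.mem_range] at hl
    omega
  · have hterm : ∀ l : ℕ, zPow (-k₀) * (LaurentPolynomial.C
        ((f.coeff (-(k₀ + l)) : F) : ℂ) * zPow (-(l : ℤ))) =
          AddMonoidAlgebra.single (-(k₀ + l)) ((f.coeff (-(k₀ + l)) : F) : ℂ) := by
      intro l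
      rw [LaurentPolynomial.single_eq_C_mul_T, mul_left_comm, zPow, zPow,
        ← LaurentPolynomial.T_add, neg_add]
    rw [map_sum, Finset.mul_sum]
    simp only [map_mul, embed_C, embed_X_pow, hterm]
    ext k
    rw [AddMonoidAlgebra.coeff_sum, Finsupp.finsetSum_apply]
    simp only [AddMonoidAlgebra.coeff_single, Finsupp.single_apply,
      AddMonoidAlgebra.coeff_mapRingHom]
    by_cases hk : k₀ ≤ -k ∧ -k ≤ k₀ + n
    · rw [Finset.sum_eq_single (-k - k₀).toNat]
      · have h : -(k₀ + ((-k - k₀).toNat : ℤ)) = k := by omega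
        rw [if_pos h, h]
        rfl
      · intro l _ hl
        rw [if_neg (by omega)]
      · intro hn
        exact absurd (Finset.mem_range.2 (by omega)) hn
    · rw [Finset.sum_eq_zero, hf k (by omega), map_zero]
      intro l hl
      rw [Finset.mem_range] at hl
      rw [if_neg (by omega)]

/-- A nonzero Laurent polynomial matrix of genus at most `n + 1` is, up to a power of `z`, a
polynomial matrix in `z⁻¹` of degree at most `n`. -/
theorem exists_eq_zPow_smul_embed (L : Matrix (Fin m) (Fin m) F[T;T⁻¹])
    (hL : toComplex F L ≠ 0) {g : ℕ} (hg : HasSize (toComplex F L) g) :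
    ∃ (k₀ : ℤ) (n : ℕ) (P : Matrix (Fin m) (Fin m) F[X]), n + 1 ≤ g ∧
      (∀ i j, (P i j).natDegree ≤ n) ∧ toComplex F L = zPow (-k₀) • (embed F).mapMatrix P := by
  have hne : (blockSupport (toComplex F L)).Nonempty := by
    by_contra hcon
    rw [Finset.not_nonempty_iff_eq_empty] at hcon
    apply hL
    ext i j k
    have hk : block (toComplex F L) (-k) = 0 := by
      by_contra h
      rw [← Ne, ← mem_blockSupport, hcon] at h
      simp at h
    simpa [block] using congrFun (congrFun hk i) j
  set k₀ := (blockSupport (toComplex F L)).min' hne with hk₀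
  set k₁ := (blockSupport (toComplex F L)).max' hne with hk₁
  have hle : k₀ ≤ k₁ := Finset.min'_le _ _ (Finset.max'_mem _ _)
  have hgen : (k₁ - k₀ + 1).toNat ≤ g := by
    have h := hg
    rw [HasSize, genus, dif_pos hne] at h
    exact h
  have hblock : ∀ k, (k < k₀ ∨ k₁ < k) → ∀ i j, (toComplex F L i j).coeff (-k) = 0 := by
    intro k hk i j
    by_contra h
    have hmem : k ∈ blockSupport (toComplex F L) := by
      rw [mem_blockSupport]
      exact fun h0 => h (by simpa [block] using congrFun (congrFun h0 i) j)
    have h1 := Finset.min'_le _ _ hmem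
    have h2 := Finset.le_max' _ _ hmem
    omega
  have hentry := fun i j => exists_eq_zPow_mul_embed (L i j) k₀ (k₁ - k₀).toNat fun k hk => by
    have h := hblock (-k) (by omega) i j
    rw [neg_neg] at h
    simpa [toComplex] using h
  choose P hP hLP using hentry
  refine ⟨k₀, (k₁ - k₀).toNat, Matrix.of P, by omega, hP, ?_⟩
  ext1 i j
  exact hLP i j

end Embedding

/-! ### The value of a wavelet pair at `z = 1` -/

section ValueAtOne

variable {m : ℕ}

theorem lowerBlock_diagOne_mul (G : Matrix (Fin (m - 1)) (Fin (m - 1)) ℂ)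
    (X : Matrix (Fin m) (Fin m) ℂ) : lowerBlock (diagOne G * X) = G * lowerBlock X := by
  cases m with
  | zero => ext i j; exact i.elim0
  | succ n =>
    ext i j
    simp only [lowerBlock, Matrix.of_apply, Matrix.mul_apply]
    rw [Fin.sum_univ_succ]
    simp [diagOne]
    rfl

theorem lowerBlock_one : lowerBlock (1 : Matrix (Fin m) (Fin m) ℂ) = 1 := by
  ext i j
  simp [lowerBlock, Matrix.one_apply, Fin.ext_iff]

/-- Two constant matrices with the linear conditions and `A Bᴴ = m I` are block diagonal up to the
Haar matrix. -/
theorem exists_diagOne_of_linear (hm : m ≠ 0) {A B : Matrix (Fin m) (Fin m) ℂ}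
    (hAB : A * Bᴴ = (m : ℂ) • (1 : Matrix (Fin m) (Fin m) ℂ))
    (hA : ∀ i, ∑ j, A i j = if (i : ℕ) = 0 then (m : ℂ) else 0)
    (hB : ∀ i, ∑ j, B i j = if (i : ℕ) = 0 then (m : ℂ) else 0) :
    IsUnit (lowerBlock ((m : ℂ)⁻¹ • (A * (canonicalHaar m)ᴴ))) ∧
      A = diagOne (lowerBlock ((m : ℂ)⁻¹ • (A * (canonicalHaar m)ᴴ))) * canonicalHaar m := by
  have hm' : (m : ℂ) ≠ 0 := Nat.cast_ne_zero.2 hm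
  set H := canonicalHaar m with hH
  have hHH : Hᴴ * H = (m : ℂ) • (1 : Matrix (Fin m) (Fin m) ℂ) := by
    have h : H * ((m : ℂ)⁻¹ • Hᴴ) = 1 := by
      rw [Matrix.mul_smul, canonicalHaar_mul_conjTranspose, smul_smul, inv_mul_cancel₀ hm',
        one_smul]
    rw [mul_eq_one_comm, Matrix.smul_mul] at h
    rw [← h, smul_smul, mul_inv_cancel₀ hm', one_smul]
  have hBA : Bᴴ * A = (m : ℂ) • (1 : Matrix (Fin m) (Fin m) ℂ) := by
    have h : A * ((m : ℂ)⁻¹ • Bᴴ) = 1 := by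
      rw [Matrix.mul_smul, hAB, smul_smul, inv_mul_cancel₀ hm', one_smul]
    rw [mul_eq_one_comm, Matrix.smul_mul] at h
    rw [← h, smul_smul, mul_inv_cancel₀ hm', one_smul]
  -- The row sums of `B` say that `(1, …, 1) Bᴴ` is `m` times the first unit row vector; multiplying
  -- `Bᴴ A = m I` by `(1, …, 1)` on the left gives row `0` of `A`.
  have hArow : ∀ i k : Fin m, (i : ℕ) = 0 → A i k = 1 := by
    intro i k hi
    have h1 : ∑ j, (Bᴴ * A) j k = m := by
      rw [hBA]
      simp [Matrix.one_apply]
    simp only [Matrix.mul_apply, Matrix.conjTranspose_apply] at h1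
    rw [Finset.sum_comm] at h1
    simp only [← Finset.sum_mul, ← star_sum, hB] at h1
    rw [Finset.sum_eq_single i] at h1
    · rw [if_pos hi, star_natCast] at h1
      exact mul_left_cancel₀ hm' (by rw [h1, mul_one])
    · intro l _ hl
      rw [if_neg (fun h => hl (Fin.ext (by omega))), star_zero, zero_mul]
    · simp
  set D := (m : ℂ)⁻¹ • (A * Hᴴ) with hD
  have hDapp : ∀ i j, D i j = (m : ℂ)⁻¹ * ∑ k, A i k * H j k := fun i j => by
    simp only [hD, Matrix.smul_apply, smul_eq_mul, Matrix.mul_apply, Matrix.conjTranspose_apply,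
      hH, star_canonicalHaar]
  -- Row `0` of `D` comes from the row sums of `H`, since row `0` of `A` is all ones; column `0`
  -- comes from the row sums of `A`, since row `0` of `H` is all ones.
  have hdiag : diagOne (lowerBlock D) = D := by
    refine diagOne_lowerBlock D (fun i j hi => ?_) fun i j hj => ?_
    · simp only [hDapp, hArow i _ hi, one_mul, hH, sum_canonicalHaar]
      split_ifs
      · exact inv_mul_cancel₀ hm'
      · exact mul_zero _
    · simp only [hDapp, hH, canonicalHaar_zero hj, mul_one, hA]
      split_ifs
      · exact inv_mul_cancel₀ hm'
      · exact mul_zero _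
  refine ⟨?_, ?_⟩
  · have h1 : D * ((m : ℂ)⁻¹ • (H * Bᴴ)) = 1 := by
      rw [hD, Matrix.smul_mul, Matrix.mul_smul, mul_assoc, ← mul_assoc Hᴴ, hHH, Matrix.smul_mul,
        one_mul, Matrix.mul_smul, hAB, smul_smul, smul_smul, smul_smul]
      rw [show (m : ℂ)⁻¹ * (m : ℂ)⁻¹ * (m : ℂ) * (m : ℂ) = 1 by field_simp, one_smul]
    have h2 := congrArg lowerBlock h1
    rw [← hdiag, lowerBlock_diagOne_mul, lowerBlock_one] at h2
    exact IsUnit.of_mul_eq_one _ h2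
  · rw [hdiag, hD, Matrix.smul_mul, mul_assoc, hHH, Matrix.mul_smul, mul_one, smul_smul,
      inv_mul_cancel₀ hm', one_smul]

end ValueAtOne

/-! ### Unit vectors and rank-one orthogonal projections over `F` -/

section UnitVectors

variable {m : ℕ}

theorem exists_smul_isUnitVector (w : Fin m → ℂ) (hw : w ≠ 0) :
    ∃ c : ℂ, IsUnitVector (c • w) := by
  obtain ⟨i, hi⟩ := Function.ne_iff.1 hw
  have hS : 0 < ∑ j, Complex.normSq (w j) :=
    Finset.sum_pos' (fun j _ => Complex.normSq_nonneg _)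
      ⟨i, Finset.mem_univ i, Complex.normSq_pos.2 hi⟩
  refine ⟨((√(∑ j, Complex.normSq (w j)))⁻¹ : ℝ), ?_⟩
  have hdot : star w ⬝ᵥ w = ((∑ j, Complex.normSq (w j) : ℝ) : ℂ) := by
    rw [Complex.ofReal_sum]
    exact Finset.sum_congr rfl fun j _ => (Complex.normSq_eq_conj_mul_self (z := w j)).symm
  rw [IsUnitVector, star_smul, smul_dotProduct, dotProduct_smul, hdot, smul_eq_mul, smul_eq_mul,
    Complex.star_def, Complex.conj_ofReal]
  norm_cast
  rw [← mul_assoc, ← mul_inv, Real.mul_self_sqrt hS.le, inv_mul_cancel₀ hS.ne']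

/-- With `u` the conjugate of `w` and `v = c u`, one gets `v v^* = |c| ^ 2 u wᵀ`, and `|c| ^ 2 = (w
⬝ᵥ u)⁻¹` lies in `F` even if `c` does not. The field `K` only records where the coordinates of `v`
itself lie. -/
theorem exists_rank_one_projection (F K : Subfield ℂ) (hF : ∀ x ∈ F, (starRingEnd ℂ) x ∈ F)
    (hK : ∀ w : Fin m → ℂ, (∀ i, w i ∈ F) → w ≠ 0 →
      ∃ c : ℂ, IsUnitVector (c • w) ∧ ∀ i, (c • w) i ∈ K) (w : Fin m → F) (hw : w ≠ 0) :
    ∃ a : Fin m → F, w ⬝ᵥ a = 1 ∧ ∃ v : Fin m → ℂ, IsUnitVector v ∧ (∀ i, v i ∈ K) ∧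
      (Matrix.vecMulVec a w).map F.subtype = Matrix.vecMulVec v (star v) := by
  let u : Fin m → F := fun i => ⟨starRingEnd ℂ (w i), hF _ (w i).2⟩
  have hu : (fun i => (u i : ℂ)) ≠ 0 := by
    obtain ⟨i, hi⟩ := Function.ne_iff.1 hw
    refine Function.ne_iff.2 ⟨i, ?_⟩
    simpa [u] using hi
  obtain ⟨c, hc, hcK⟩ := hK (fun i => (u i : ℂ)) (fun i => (u i).2) hu
  have hS : (starRingEnd ℂ c * c) * ((w ⬝ᵥ u : F) : ℂ) = 1 := by
    rw [← hc]
    simp only [dotProduct, Pi.star_apply, Pi.smul_apply, smul_eq_mul,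
      AddSubmonoidClass.coe_finsetSum, Finset.mul_sum]
    refine Finset.sum_congr rfl fun i _ => ?_
    simp [u]
    ring
  have hS0 : (w ⬝ᵥ u : F) ≠ 0 := by
    intro h
    rw [h] at hS
    simp at hS
  refine ⟨(w ⬝ᵥ u)⁻¹ • u, ?_, _, hc, hcK, ?_⟩
  · rw [dotProduct_smul, smul_eq_mul, inv_mul_cancel₀ hS0]
  · ext i j
    have hinv : (((w ⬝ᵥ u)⁻¹ : F) : ℂ) = starRingEnd ℂ c * c := by
      rw [Subfield.coe_inv]
      exact (eq_inv_of_mul_eq_one_left hS).symm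
    simp only [Matrix.map_apply, Matrix.vecMulVec_apply, Pi.smul_apply, smul_eq_mul, map_mul,
      Pi.star_apply, Subfield.subtype_apply, hinv]
    simp [u]
    ring

end UnitVectors

/-! ### Biorthogonal wavelet pairs factor -/

section Necessity

open Polynomial

variable {m : ℕ}

theorem ofFn_comp_get {α β : Type*} (l : List α) (f : α → β) :
    (List.ofFn fun i : Fin l.length => f (l.get i)) = l.map f := by
  conv_rhs => rw [← List.ofFn_get l, List.map_ofFn]
  rfl

theorem primitiveParaunitary_eq_leftFactor (v : Fin m → ℂ) :
    primitiveParaunitary v = leftFactor (Matrix.vecMulVec v (star v)) 1 := by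
  simp [primitiveParaunitary, leftFactor]

theorem embed_list_prod {F : Subfield ℂ} {ι : Type*} (l : List ι)
    (f : ι → Matrix (Fin m) (Fin m) F) (k : ι → ℕ) :
    (embed F).mapMatrix (l.map fun p => shiftFactor (f p) (k p)).prod =
      (l.map fun p => leftFactor ((f p).map F.subtype) (k p)).prod := by
  rw [map_list_prod, List.map_map]
  congr 1
  exact List.map_congr_left fun p _ => embed_shiftFactor (f p) (k p)

theorem isUnit_det_of_mul_adj (hm : m ≠ 0) {L R : LMat m}
    (h : L * adj R = (m : ℂ[T;T⁻¹]) • (1 : LMat m)) : IsUnit L.det := by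
  have hc : (LaurentPolynomial.C ((m : ℂ)⁻¹) : ℂ[T;T⁻¹]) * (m : ℂ[T;T⁻¹]) = 1 := by
    rw [← map_natCast (LaurentPolynomial.C (R := ℂ)), ← map_mul,
      inv_mul_cancel₀ (Nat.cast_ne_zero.2 hm), map_one]
  refine Matrix.isUnit_det_of_right_inverse
    (B := (LaurentPolynomial.C ((m : ℂ)⁻¹) : ℂ[T;T⁻¹]) • adj R) ?_
  rw [Matrix.mul_smul, h, smul_smul, hc, one_smul]

/-- The polynomial part of the factorization: a polynomial matrix with monomial determinant
splits into paraunitary factors, factors `I - N + N X ^ k`, and its value at `1`. -/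
theorem exists_polynomial_factorization {F : Subfield ℂ} (T : Matrix (Fin m) (Fin m) F → Prop)
    (hT : ∀ w : Fin m → F, w ≠ 0 → ∃ a, w ⬝ᵥ a = 1 ∧ T (Matrix.vecMulVec a w))
    (P : Matrix (Fin m) (Fin m) F[X]) {n d : ℕ} {c : F} (hc : c ≠ 0)
    (hdet : P.det = C c * X ^ d) (hdeg : ∀ i j, (P i j).natDegree ≤ n) :
    ∃ (lW : List (Matrix (Fin m) (Fin m) F)) (lN : List (Matrix (Fin m) (Fin m) F × ℕ)),
      lW.length = d ∧ (∀ W ∈ lW, T W) ∧ lN ≠ [] ∧ (∀ p ∈ lN, p.1 ^ 2 = 0 ∧ 0 < p.2) ∧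
      (∀ i j, ((lN.map fun p => shiftFactor p.1 p.2).prod i j).natDegree ≤ n) ∧
      P = (lW.map fun W => shiftFactor W 1).prod * (lN.map fun p => shiftFactor p.1 p.2).prod *
        (evalOne P).map C := by
  have hdet1 : (evalOne P).det = c := by
    rw [evalOne, ← RingHom.map_det, hdet]
    simp
  have hu : IsUnit (evalOne P).det := by rw [hdet1]; exact hc.isUnit
  -- Dividing by the value at `1` first makes the unimodular part `Q` equal to `I` at `1`, because
  -- the rank-one factors are `I` there.
  set B := (evalOne P)⁻¹ with hB
  have hBdet : B.det ≠ 0 := by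
    rw [hB, Matrix.det_nonsing_inv, hdet1, Ring.inverse_eq_inv']
    exact inv_ne_zero hc
  have hdet' : (P * B.map C).det = C (c * B.det) * X ^ d := by
    have h : (B.map (C : F →+* F[X])).det = C B.det := (RingHom.map_det C B).symm
    rw [Matrix.det_mul, hdet, h, C_mul]
    ring
  have hdeg' : ∀ i j, ((P * B.map C) i j).natDegree ≤ n := fun i j => by
    rw [Matrix.mul_apply]
    exact natDegree_sum_le_of_forall_le _ _ fun l _ => (natDegree_mul_C_le _ _).trans (hdeg i l)
  obtain ⟨lW, hlen, hlW, Q, hQ, hQn, hPQ⟩ :=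
    exists_eq_prod_shiftFactor_mul T hT n _ (mul_ne_zero hc hBdet) d _ hdet' hdeg'
  have hQ1 : evalOne Q = 1 := by
    have h := congrArg evalOne hPQ
    rw [map_mul, map_mul, evalOne_map_C, evalOne_list_prod lW (fun W => W) (fun _ => 1), one_mul,
      hB, Matrix.mul_nonsing_inv _ hu] at h
    exact h.symm
  obtain ⟨l, hl, hQl⟩ := exists_eq_prod_of_isUnit_det Q hQ hQ1
  -- The trivial factor with `N = 0` guarantees `r ≥ 1`.
  have hprod : (((0, 1) :: l).map fun p : Matrix (Fin m) (Fin m) F × ℕ =>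
      shiftFactor p.1 p.2).prod = Q := by
    have h0 : shiftFactor (0 : Matrix (Fin m) (Fin m) F) 1 = 1 := by
      simp [shiftFactor, Matrix.map_zero]
    rw [List.map_cons, List.prod_cons, h0, one_mul, hQl]
  refine ⟨lW, (0, 1) :: l, hlen, hlW, by simp, ?_, ?_, ?_⟩
  · intro p hp
    rcases List.mem_cons.1 hp with rfl | hp
    · simp
    · exact hl p hp
  · rw [hprod]
    exact hQn
  · rw [hprod, ← hPQ, mul_assoc, ← map_C_mul, hB, Matrix.nonsing_inv_mul _ hu, map_C_one, mul_one]

theorem IsBiorthogonalWaveletPair.hasFactorization (F K : Subfield ℂ)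
    (hF : ∀ x ∈ F, (starRingEnd ℂ) x ∈ F) (hm : m ≠ 0) (hH : ∀ i j, canonicalHaar m i j ∈ F)
    (hK : ∀ w : Fin m → ℂ, (∀ i, w i ∈ F) → w ≠ 0 →
      ∃ c : ℂ, IsUnitVector (c • w) ∧ ∀ i, (c • w) i ∈ K) {g : ℕ}
    {L : Matrix (Fin m) (Fin m) F[T;T⁻¹]} {R : LMat m} (hg : HasSize (toComplex F L) g)
    (h : IsBiorthogonalWaveletPair (toComplex F L) R) :
    HasFactorization F K g (toComplex F L) R := by
  have hunit := isUnit_det_of_mul_adj hm h.quadratic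
  have hne : toComplex F L ≠ 0 := by
    intro h0
    have : Nonempty (Fin m) := Fin.pos_iff_nonempty.1 (Nat.pos_of_ne_zero hm)
    rw [h0, Matrix.det_zero] at hunit
    exact not_isUnit_zero hunit
  obtain ⟨k₀, n, P, hng, hdeg, hLP⟩ := exists_eq_zPow_smul_embed L hne hg
  have hdetL : (toComplex F L).det = zPow (-k₀) ^ m * embed F P.det := by
    rw [hLP, Matrix.det_smul, Fintype.card_fin, ← RingHom.map_det]
  have hunitP : IsUnit (embed F P.det) := by
    rw [hdetL] at hunit
    exact isUnit_of_mul_isUnit_right hunit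
  obtain ⟨c, d, hc, hdet⟩ := eq_C_mul_X_pow_of_isUnit_embed F _ hunitP
  obtain ⟨lW, lN, rfl, hlW, hlN0, hlN, hdegN, hP⟩ := exists_polynomial_factorization
    (fun W => ∃ v : Fin m → ℂ, IsUnitVector v ∧ (∀ i, v i ∈ K) ∧
      W.map F.subtype = Matrix.vecMulVec v (star v))
    (exists_rank_one_projection F K hF hK) P hc hdet hdeg
  have hone : atOne (toComplex F L) = (evalOne P).map F.subtype := by
    rw [hLP, atOne_smul, atOne_embed]
  have hquad1 : atOne (toComplex F L) * (atOne R)ᴴ = (m : ℂ) • 1 := by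
    have := congrArg atOne h.quadratic
    rwa [map_mul, atOne_adj, natCast_smul_one_eq_const, atOne_const] at this
  obtain ⟨hGu, hG⟩ := exists_diagOne_of_linear hm hquad1
    (fun i => by rw [← rowSum_eq, h.linear_left]) fun i => by rw [← rowSum_eq, h.linear_right]
  -- That the Haar matrix has entries in `F` is what puts the entries of `G` into `F`.
  let HF : Matrix (Fin m) (Fin m) F := Matrix.of fun i j => ⟨canonicalHaar m j i, hH j i⟩
  have hHF : HF.map F.subtype = (canonicalHaar m)ᴴ := by
    ext i j
    simp [HF, star_canonicalHaar]
  let G₀ : Matrix (Fin (m - 1)) (Fin (m - 1)) F := lowerBlock ((m : F)⁻¹ • (evalOne P * HF))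
  have hG₀ : G₀.map F.subtype =
      lowerBlock ((m : ℂ)⁻¹ • (atOne (toComplex F L) * (canonicalHaar m)ᴴ)) := by
    rw [hone, ← hHF, ← Matrix.map_mul]
    ext i j
    simp [G₀, lowerBlock]
  rw [← hG₀] at hGu hG
  have hdetG : G₀.det ≠ 0 := by
    intro h0
    rw [Matrix.isUnit_iff_isUnit_det] at hGu
    have h1 : (G₀.map F.subtype).det = F.subtype G₀.det := (RingHom.map_det F.subtype G₀).symm
    rw [h1, h0, map_zero] at hGu
    exact not_isUnit_zero hGu
  choose v hv hvK hvW using fun s : Fin lW.length => hlW (lW.get s) (List.get_mem _ _)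
  -- The list is reversed because the required product runs from `N_r` down to `N_1`.
  let N : Fin lN.reverse.length → Matrix (Fin m) (Fin m) F := fun i => (lN.reverse.get i).1
  let k : Fin lN.reverse.length → ℕ := fun i => (lN.reverse.get i).2
  have hmem : ∀ i, lN.reverse.get i ∈ lN := fun i => List.mem_reverse.1 (List.get_mem _ _)
  let G := Matrix.GeneralLinearGroup.mkOfDetNeZero G₀ hdetG
  have hVprod : (embed F).mapMatrix (lW.map fun W => shiftFactor W 1).prod =
      (List.ofFn fun s => primitiveParaunitary (v s)).prod := by
    rw [embed_list_prod lW (fun W => W) fun _ => 1]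
    simp only [primitiveParaunitary_eq_leftFactor, ← hvW]
    rw [ofFn_comp_get lW fun W => leftFactor (W.map F.subtype) 1]
  have hNprod : (embed F).mapMatrix (lN.map fun p => shiftFactor p.1 p.2).prod =
      (List.ofFn fun i => leftFactor ((N i).map F.subtype) (k i)).reverse.prod := by
    rw [embed_list_prod lN Prod.fst Prod.snd,
      ofFn_comp_get lN.reverse fun p => leftFactor (p.1.map F.subtype) p.2, List.map_reverse,
      List.reverse_reverse]
  have hLfac : toComplex F L = zPow (-k₀) •
      ((List.ofFn fun s => primitiveParaunitary (v s)).prod *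
        (List.ofFn fun i => leftFactor ((N i).map F.subtype) (k i)).reverse.prod *
        const (diagOne ((G : Matrix (Fin (m - 1)) (Fin (m - 1)) F).map F.subtype)) *
        const (canonicalHaar m)) := by
    rw [← hVprod, ← hNprod, mul_assoc _ (const _), ← const_mul]
    change _ = zPow (-k₀) • (_ * _ * const (diagOne (G₀.map F.subtype) * canonicalHaar m))
    rw [← hG, hone, ← embed_map_C, ← map_mul, ← map_mul, ← hP, hLP]
  -- The scalar `z ^ (-k₀)` contributes `z ^ (-m k₀)` to the determinant, hence `b = d + m k₀`.
  refine ⟨k₀, lW.length + m * k₀, lW.length, lN.reverse.length, v, N, k, G, ?_, by ring, hv, hvK,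
    ?_, ?_, fun i => (hlN _ (hmem i)).1, fun i => (hlN _ (hmem i)).2, ?_, hLfac, ?_⟩
  · refine ⟨c, by simpa using hc, ?_⟩
    rw [hdetL, hdet, map_mul, embed_C, embed_X_pow, mul_left_comm, zPow, zPow, zPow,
      LaurentPolynomial.T_pow, ← LaurentPolynomial.T_add]
    congr 2
    ring
  · intro s i j
    rw [← hvW s]
    exact (lW.get s i j).2
  · exact List.length_pos_of_ne_nil (by simpa using hlN0)
  · rw [← hNprod]
    exact (genus_embed_le _ n hdegN).trans hng
  -- No factorization of `R` is carried out: the proposed product is also a right partner of `L`,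
  -- and the partner is unique.
  · refine eq_of_mul_adj_eq hm h.quadratic ?_
    rw [hLfac]
    exact mul_adj_of_factors k₀ _ _ _ _ _ _ (paraunitary_prod_mul_adj v hv)
      (left_prod_mul_adj_right_prod _ (fun i => map_subtype_sq F (hlN _ (hmem i)).1) k)
      (diagOne_mul_conjTranspose F G) canonicalHaar_mul_conjTranspose

end Necessity

end BiorthWavelet

end

/-! ### The equivalence, with unit vectors over `ℂ` and over `F` -/

open BiorthWavelet in
theorem theorem3p2 (F : Subfield ℂ) (hF : ∀ x ∈ F, (starRingEnd ℂ) x ∈ F)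
    (m : ℕ) (hm : 2 ≤ m) (hH : ∀ i j, canonicalHaar m i j ∈ F) (g : ℕ)
    (L R : Matrix (Fin m) (Fin m) (LaurentPolynomial F))
    (hL : HasSize (toComplex F L) g) (hR : HasSize (toComplex F R) g) :
    (IsBiorthogonalWaveletPair (toComplex F L) (toComplex F R) ↔
      HasFactorization F ⊤ g (toComplex F L) (toComplex F R)) ∧
    ((∀ w : Fin m → ℂ, (∀ i, w i ∈ F) → w ≠ 0 → ∃ c ∈ F, IsUnitVector (c • w)) →
      (IsBiorthogonalWaveletPair (toComplex F L) (toComplex F R) ↔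
        HasFactorization F F g (toComplex F L) (toComplex F R))) := by
  have hm0 : m ≠ 0 := by omega
  refine ⟨⟨fun h => h.hasFactorization F ⊤ hF hm0 hH ?_ hL,
    fun h => h.isBiorthogonalWaveletPair⟩, fun hw =>
    ⟨fun h => h.hasFactorization F F hF hm0 hH ?_ hL, fun h => h.isBiorthogonalWaveletPair⟩⟩
  · intro w _ hw
    obtain ⟨c, hc⟩ := exists_smul_isUnitVector w hw
    exact ⟨c, hc, fun i => Subfield.mem_top _⟩
  · intro w hwF hw0
    obtain ⟨c, hcF, hc⟩ := hw w hwF hw0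
    exact ⟨c, hc, fun i => F.mul_mem hcF (hwF i)⟩
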